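/- Let $\mathbb F$ be a field and let $\Lambda$ be a finite-dimensional hereditary $\mathbb F$-algebra, i.e. every submodule of a projective left $\Lambda$-module is projective. Write $(-)^*=\operatorname{Hom}_{\mathbb F}(-,\mathbb F)$. Let $\tau^-$ be the inverse Auslander–Reiten translation, regarded as an endofunctor of left $\Lambda$-modules, $\tau^-M=\operatorname{Ext}^1_{\Lambda^{\mathrm{op}}}(M^*,\Lambda)$ (the transpose over a hereditary algebra being $\operatorname{Ext}^1(-,\Lambda)$); the endofunctor $\tau^-$ of right $\Lambda$-modules is defined in the same way, with $\Lambda^{\mathrm{op}}$ in place of $\Lambda$. Write $\tau^{-r}$ for the $r$-th iterate of $\tau^-$. The left and the right preprojective algebra of $\Lambda$ are $$\Pi_{\ell}=\bigoplus_{r\ge 0}\operatorname{Hom}_\Lambda(\Lambda,\tau^{-r}\Lambda),\qquad \Pi_{\mathrm r}=\bigoplus_{r\ge 0}\operatorname{Hom}_{\Lambda^{\mathrm{op}}}(\Lambda,\tau^{-r}\Lambda),$$ each graded by $r$, where the product of $g:\Lambda\to\tau^{-s}\Lambda$ and $f:\Lambda\to\tau^{-r}\Lambda$ is $gf=\tau^{-r}g\circ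 f:\Lambda\to\tau^{-r-s}\Lambda$. Write $L_r$ for $\tau^{-r}\Lambda$ formed with left modules, and $R_r$ for $\tau^{-r}\Lambda$ formed with right modules. Both are $\Lambda$-$\Lambda$-bimodules: the second action comes, by functoriality, from the right (respectively left) multiplications on $\Lambda$. Then $L_1$ and $R_1$ are isomorphic as bimodules. Moreover, for every bimodule isomorphism $\theta_1:L_1\to R_1$ there is exactly one way to choose bimodule isomorphisms $\theta_r:L_r\to R_r$ for all $r\geq 0$, with $\theta_0=\operatorname{id}_\Lambda$ and with the given $\theta_1$, such that, identifying $L_r$ with $R_r$ along $\theta_r$ and writing $\tau^{-r}\Lambda$ for both, there is a grading-preserving $\mathbb F$-algebra anti-isomorphism $$R:\Pi_{\ell}\to\Pi_{\mathrm r},\qquad f\mapsto \ell_{f(1)}\quad\text{for } f:\Lambda\to\tau^{-r}\Lambda,$$ where $\ell_y:\Lambda\to\tau^{-r}\Lambda$ is the left multiplication $a\mapsto ya$, and such that the following holds. For all idempotents $e_i,e_j\in\Lambda$ put $P_i=\Lambda e_i$ and ${}_iP=e_i\Lambda\cong\operatorname{Hom}_\Lambda(P_i,\Lambda)$, and likewise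 for $j$; regard $\operatorname{Hom}_\Lambda(P_i,\tau^{-r}P_j)$ as a subspace of $\operatorname{Hom}_\Lambda(\Lambda,\tau^{-r}\Lambda)$, and $\operatorname{Hom}_{\Lambda^{\mathrm{op}}}({}_jP,\tau^{-r}({}_iP))$ as a subspace of $\operatorname{Hom}_{\Lambda^{\mathrm{op}}}(\Lambda,\tau^{-r}\Lambda)$, via the inclusions of, and the projections $x\mapsto xe$ (respectively $x\mapsto ex$) onto, these direct summands of $\Lambda$. Then, for every $r\ge 0$, $R$ maps $\operatorname{Hom}_\Lambda(P_i,\tau^{-r}P_j)$ isomorphically onto $\operatorname{Hom}_{\Lambda^{\mathrm{op}}}({}_jP,\tau^{-r}({}_iP))$. -/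

import Mathlib

open CategoryTheory CategoryTheory.Abelian MulOpposite
open scoped ModuleCat DirectSum

universe u

/-- A ring is (left) hereditary if every submodule of a projective (left) module is projective. -/
def IsHereditary (A : Type u) [Ring A] : Prop :=
  ∀ (M : Type u) [AddCommGroup M] [Module A M] [Module.Projective A M] (N : Submodule A M),
    Module.Projective A N

namespace Preproj

noncomputable section

section Translate

variable (F : Type u) [Field F] (A : Type u) [Ring A] [Algebra F A]

/-- The `F`-linear dual `M* = Hom_F(M, F)` of a left `A`-module, as a right `A`-module
(i.e. a left `Aᵐᵒᵖ`-module): `(φ · a)(m) = φ (a m)`. -/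
abbrev dualModule (M : ModuleCat.{u} A) : Module Aᵐᵒᵖ (Module.Dual F M) where
  smul a φ := φ.comp (Algebra.lsmul F F M a.unop)
  one_smul φ := LinearMap.ext fun m => congrArg φ (one_smul A m)
  mul_smul a b φ := LinearMap.ext fun m => congrArg φ (mul_smul b.unop a.unop m)
  smul_zero _ := rfl
  smul_add _ _ _ := rfl
  add_smul a b φ := LinearMap.ext fun m =>
    (congrArg φ (add_smul a.unop b.unop m)).trans (map_add φ _ _)
  zero_smul φ := LinearMap.ext fun m => (congrArg φ (zero_smul A m)).trans (map_zero φ)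

/-- The right `A`-module `M*`, as an object of the category of right `A`-modules. -/
def dualObj (M : ModuleCat.{u} A) : ModuleCat.{u} Aᵐᵒᵖ :=
  letI := dualModule F A M
  ModuleCat.of Aᵐᵒᵖ (Module.Dual F M)

/-- The transpose `f* : N* → M*`, `φ ↦ φ ∘ f`, of a map `f : M → N`. -/
def dualMap {M N : ModuleCat.{u} A} (f : M ⟶ N) : dualObj F A N ⟶ dualObj F A M :=
  letI := dualModule F A M
  letI := dualModule F A N
  ModuleCat.ofHom
    { toFun := fun φ : Module.Dual F N => φ.comp (f.hom.restrictScalars F)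
      map_add' := fun _ _ => rfl
      map_smul' := fun a φ => LinearMap.ext fun m => congrArg φ (map_smul f.hom a.unop m).symm }

theorem dualMap_id (M : ModuleCat.{u} A) : dualMap F A (𝟙 M) = 𝟙 _ := rfl

theorem dualMap_comp {L M N : ModuleCat.{u} A} (f : L ⟶ M) (g : M ⟶ N) :
    dualMap F A (f ≫ g) = dualMap F A g ≫ dualMap F A f := rfl

theorem dualMap_add {M N : ModuleCat.{u} A} (f g : M ⟶ N) :
    dualMap F A (f + g) = dualMap F A f + dualMap F A g := by
  refine ModuleCat.hom_ext (LinearMap.ext fun φ => ?_)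
  exact LinearMap.ext fun m => map_add (show Module.Dual F N from φ) (f m) (g m)

theorem dualMap_smul {M N : ModuleCat.{u} A} (c : F) (f : M ⟶ N) :
    dualMap F A (c • f) = c • dualMap F A f := by
  refine ModuleCat.hom_ext (LinearMap.ext fun φ => ?_)
  exact LinearMap.ext fun m => congrArg (show Module.Dual F N from φ)
    (map_smul f.hom (algebraMap F A c) m).symm

/-- The regular right `A`-module. -/
def rightRegular : ModuleCat.{u} Aᵐᵒᵖ := ModuleCat.of Aᵐᵒᵖ A

/-- Left multiplication by `a`, an endomorphism of the regular right module. -/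
def lmul (a : A) : rightRegular A ⟶ rightRegular A :=
  ModuleCat.ofHom
    { toFun := fun x : A => a * x
      map_add' := mul_add a
      map_smul' := fun b x => (mul_assoc a x b.unop).symm }

theorem lmul_one : lmul A 1 = 𝟙 _ :=
  ModuleCat.hom_ext (LinearMap.ext fun x => one_mul (show A from x))

theorem lmul_mul (a b : A) : lmul A (a * b) = lmul A b ≫ lmul A a :=
  ModuleCat.hom_ext (LinearMap.ext fun x => mul_assoc a b (show A from x))

theorem lmul_add (a b : A) : lmul A (a + b) = lmul A a + lmul A b :=
  ModuleCat.hom_ext (LinearMap.ext fun x => add_mul a b (show A from x))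

theorem lmul_algebraMap (c : F) : lmul A (algebraMap F A c) = c • 𝟙 (rightRegular A) :=
  ModuleCat.hom_ext (LinearMap.ext fun x => Algebra.commutes c (show A from x))

/-- The abelian group `Ext¹(M*, A)`, the extension group in the category of right `A`-modules. -/
abbrev TauGroup (M : ModuleCat.{u} A) : Type u := Ext (dualObj F A M) (rightRegular A) 1

/-- The left `A`-module structure on `Ext¹(M*, A)`, induced by the left multiplications on `A`. -/
abbrev tauModule (M : ModuleCat.{u} A) : Module A (TauGroup F A M) where
  smul a x := x.comp (Ext.mk₀ (lmul A a)) (add_zero 1)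
  one_smul x := by
    change x.comp (Ext.mk₀ (lmul A 1)) (add_zero 1) = x
    rw [lmul_one, Ext.comp_mk₀_id]
  mul_smul a b x := by
    change x.comp (Ext.mk₀ (lmul A (a * b))) (add_zero 1) =
      (x.comp (Ext.mk₀ (lmul A b)) (add_zero 1)).comp (Ext.mk₀ (lmul A a)) (add_zero 1)
    rw [lmul_mul, Ext.comp_assoc_of_third_deg_zero, Ext.mk₀_comp_mk₀]
  smul_zero a := by
    change (0 : TauGroup F A M).comp (Ext.mk₀ (lmul A a)) (add_zero 1) = 0
    rw [Ext.zero_comp]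
  smul_add a x y := Ext.add_comp _ _ _ _
  add_smul a b x := by
    change x.comp (Ext.mk₀ (lmul A (a + b))) (add_zero 1) =
      x.comp (Ext.mk₀ (lmul A a)) (add_zero 1) + x.comp (Ext.mk₀ (lmul A b)) (add_zero 1)
    rw [lmul_add, Ext.mk₀_add, Ext.comp_add]
  zero_smul x := by
    change x.comp (Ext.mk₀ (lmul A 0)) (add_zero 1) = 0
    have h : lmul A 0 = 0 :=
      ModuleCat.hom_ext (LinearMap.ext fun x => zero_mul (show A from x))
    rw [h, Ext.mk₀_zero, Ext.comp_zero]

/-- The inverse Auslander-Reiten translation `τ⁻` of a hereditary algebra `A`, as an endofunctor: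
`τ⁻ = Tr D`, where `D = (-)*` and the transpose `Tr` of a right module `N` over a hereditary
algebra is the left module `Ext¹(N, A)`. Thus `τ⁻ M = Ext¹(M*, A)`. -/
def tauMinus : ModuleCat.{u} A ⥤ ModuleCat.{u} A where
  obj M :=
    letI := tauModule F A M
    ModuleCat.of A (TauGroup F A M)
  map {M N} f :=
    letI := tauModule F A M
    letI := tauModule F A N
    ModuleCat.ofHom
      { toFun := fun x : TauGroup F A M => (Ext.mk₀ (dualMap F A f)).comp x (zero_add 1)
        map_add' := fun _ _ => Ext.comp_add _ _ _ _
        map_smul' := fun a x =>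
          (Ext.comp_assoc_of_third_deg_zero (Ext.mk₀ (dualMap F A f)) x
            (Ext.mk₀ (lmul A a)) (zero_add 1)).symm }
  map_id M :=
    letI := tauModule F A M
    ModuleCat.hom_ext (LinearMap.ext fun x => Ext.mk₀_id_comp (show TauGroup F A M from x))
  map_comp {L M N} f g :=
    letI := tauModule F A L
    letI := tauModule F A M
    letI := tauModule F A N
    ModuleCat.hom_ext (LinearMap.ext fun x =>
      (Ext.mk₀_comp_mk₀_assoc (dualMap F A g) (dualMap F A f) (show TauGroup F A L from x)).symm)

instance : (tauMinus F A).Additive where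
  map_add {M N f g} := ModuleCat.hom_ext (LinearMap.ext fun x => by
    change (Ext.mk₀ (dualMap F A (f + g))).comp (show TauGroup F A M from x) (zero_add 1) =
      (Ext.mk₀ (dualMap F A f)).comp (show TauGroup F A M from x) (zero_add 1) +
      (Ext.mk₀ (dualMap F A g)).comp (show TauGroup F A M from x) (zero_add 1)
    rw [dualMap_add, Ext.mk₀_add, Ext.add_comp])

instance : (tauMinus F A).Linear F where
  map_smul {M N} f c := ModuleCat.hom_ext (LinearMap.ext fun x => by
    change (Ext.mk₀ (dualMap F A (c • f))).comp (show TauGroup F A M from x) (zero_add 1) =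
      ((Ext.mk₀ (dualMap F A f)).comp (show TauGroup F A M from x) (zero_add 1)).comp
        (Ext.mk₀ (lmul A (algebraMap F A c))) (add_zero 1)
    rw [dualMap_smul, lmul_algebraMap, ← Ext.smul_eq_comp_mk₀, Ext.mk₀_smul, Ext.smul_comp])

/-- The iterates `τ^{-r}`. -/
def tauPow : ℕ → (ModuleCat.{u} A ⥤ ModuleCat.{u} A)
  | 0 => 𝟭 _
  | r + 1 => tauPow r ⋙ tauMinus F A

instance tauPow_additive (r : ℕ) : (tauPow F A r).Additive := by
  induction r with
  | zero => exact inferInstanceAs (𝟭 (ModuleCat.{u} A)).Additive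
  | succ r ih => exact inferInstanceAs (tauPow F A r ⋙ tauMinus F A).Additive

instance tauPow_linear (r : ℕ) : (tauPow F A r).Linear F := by
  induction r with
  | zero => exact inferInstanceAs ((𝟭 (ModuleCat.{u} A)).Linear F)
  | succ r ih => exact inferInstanceAs ((tauPow F A r ⋙ tauMinus F A).Linear F)

theorem tauPow_add (s r : ℕ) : tauPow F A s ⋙ tauPow F A r = tauPow F A (s + r) := by
  induction r with
  | zero => rfl
  | succ r ih =>
    change (tauPow F A s ⋙ tauPow F A r) ⋙ tauMinus F A = tauPow F A (s + r) ⋙ tauMinus F A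
    rw [ih]

/-- `τ^{-r} τ^{-s} M = τ^{-(s+r)} M`. -/
theorem tauPow_obj (s r : ℕ) (M : ModuleCat.{u} A) :
    (tauPow F A r).obj ((tauPow F A s).obj M) = (tauPow F A (s + r)).obj M :=
  congrArg (fun G : ModuleCat.{u} A ⥤ ModuleCat.{u} A => G.obj M) (tauPow_add F A s r)

/-- The left module `τ^{-r} A`, where `A` is the regular left module. -/
abbrev T (r : ℕ) : ModuleCat.{u} A := (tauPow F A r).obj (ModuleCat.of A A)

/-- Right multiplication by `a`, an endomorphism of the regular left module. -/
def rmul (a : A) : ModuleCat.of A A ⟶ ModuleCat.of A A :=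
  ModuleCat.ofHom (LinearMap.toSpanSingleton A A a)

/-- The second action of `a : A` on `τ^{-r} A`, from the right multiplication by `a` on the
regular left module `A` by functoriality. It makes `τ^{-r} A` a bimodule. -/
def rightAct (r : ℕ) (a : A) (x : T F A r) : T F A r :=
  (tauPow F A r).map (rmul A a) x

/-- The map `A → τ^{-r} A`, `a ↦ a y`, for `y ∈ τ^{-r} A`. When `A = Λᵐᵒᵖ` so that `τ^{-r} A` is a
right `Λ`-module, this is `a ↦ y a`, i.e. left multiplication by `y`. -/
def mulMap (r : ℕ) (y : T F A r) : ModuleCat.of A A ⟶ T F A r :=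
  ModuleCat.ofHom (LinearMap.toSpanSingleton A (T F A r) y)

/-- The degree `r` part `Hom_A(A, τ^{-r} A)` of the preprojective algebra. -/
abbrev Piece (r : ℕ) : Type u := ModuleCat.of A A ⟶ T F A r

/-- The product `g f = τ^{-r} g ∘ f` of `g : A → τ^{-s} A` and `f : A → τ^{-r} A`. -/
def pieceMul {s r : ℕ} (g : Piece F A s) (f : Piece F A r) : Piece F A (s + r) :=
  f ≫ (tauPow F A r).map g ≫ eqToHom (tauPow_obj F A s r (ModuleCat.of A A))

/-- The identity of `A`, the unit of the preprojective algebra. -/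
def pieceOne : Piece F A 0 := 𝟙 (ModuleCat.of A A)

theorem pieceMul_zero {s r : ℕ} (g : Piece F A s) : pieceMul F A g (0 : Piece F A r) = 0 := by
  simp [pieceMul]

theorem zero_pieceMul {s r : ℕ} (f : Piece F A r) : pieceMul F A (0 : Piece F A s) f = 0 := by
  simp [pieceMul, Functor.map_zero]

theorem pieceMul_add {s r : ℕ} (g : Piece F A s) (f f' : Piece F A r) :
    pieceMul F A g (f + f') = pieceMul F A g f + pieceMul F A g f' := by
  simp [pieceMul]

theorem add_pieceMul {s r : ℕ} (g g' : Piece F A s) (f : Piece F A r) :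
    pieceMul F A (g + g') f = pieceMul F A g f + pieceMul F A g' f := by
  simp [pieceMul, Functor.map_add]

theorem pieceMul_smul {s r : ℕ} (c : F) (g : Piece F A s) (f : Piece F A r) :
    pieceMul F A g (c • f) = c • pieceMul F A g f := by
  simp [pieceMul]

theorem smul_pieceMul {s r : ℕ} (c : F) (g : Piece F A s) (f : Piece F A r) :
    pieceMul F A (c • g) f = c • pieceMul F A g f := by
  simp [pieceMul, Functor.map_smul]

theorem mk_eq_mk {s r : ℕ} (h : s = r) (f : Piece F A s) (g : Piece F A r)
    (hfg : f ≫ eqToHom (congrArg (T F A) h) = g) :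
    (GradedMonoid.mk s f : GradedMonoid (Piece F A)) = GradedMonoid.mk r g := by
  subst h
  simp only [eqToHom_refl, Category.comp_id] at hfg
  rw [hfg]

theorem mk_one_mul {r : ℕ} (f : Piece F A r) :
    (GradedMonoid.mk (0 + r) (pieceMul F A (pieceOne F A) f) : GradedMonoid (Piece F A)) =
      GradedMonoid.mk r f := by
  refine mk_eq_mk F A (zero_add r) _ _ ?_
  have h : (tauPow F A r).map (pieceOne F A) = 𝟙 _ := (tauPow F A r).map_id _
  calc pieceMul F A (pieceOne F A) f ≫ eqToHom (congrArg (T F A) (zero_add r))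
      = (f ≫ 𝟙 (T F A r) ≫ eqToHom _) ≫ eqToHom _ :=
        congrArg (fun k => (f ≫ k ≫ eqToHom (tauPow_obj F A 0 r (ModuleCat.of A A))) ≫
          eqToHom (congrArg (T F A) (zero_add r))) h
    _ = f := by simp

theorem mul_pieceOne {r : ℕ} (f : Piece F A r) : pieceMul F A f (pieceOne F A) = f := by
  change 𝟙 _ ≫ f ≫ 𝟙 _ = f
  rw [Category.id_comp, Category.comp_id]

theorem mk_mul_assoc {t s r : ℕ} (h : Piece F A t) (g : Piece F A s) (f : Piece F A r) :
    (GradedMonoid.mk (t + s + r) (pieceMul F A (pieceMul F A h g) f) :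
      GradedMonoid (Piece F A)) =
      GradedMonoid.mk (t + (s + r)) (pieceMul F A h (pieceMul F A g f)) := by
  refine mk_eq_mk F A (add_assoc t s r) _ _ ?_
  have key := Functor.congr_hom (tauPow_add F A s r) h
  simp only [Functor.comp_map] at key
  simp only [pieceMul, Functor.map_comp, Category.assoc, key, eqToHom_map, eqToHom_trans]

instance : GradedMonoid.GMul (Piece F A) where
  mul := pieceMul F A

instance : GradedMonoid.GOne (Piece F A) where
  one := pieceOne F A

instance : GradedMonoid.GMonoid (Piece F A) where
  one_mul f := mk_one_mul F A f.2
  mul_one f := congrArg (GradedMonoid.mk f.1) (mul_pieceOne F A f.2)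
  mul_assoc h g f := mk_mul_assoc F A h.2 g.2 f.2

instance : DirectSum.GRing (Piece F A) where
  mul_zero g := pieceMul_zero F A g
  zero_mul f := zero_pieceMul F A f
  mul_add := pieceMul_add F A
  add_mul := add_pieceMul F A
  natCast n := n • pieceOne F A
  natCast_zero := zero_smul _ _
  natCast_succ _ := succ_nsmul _ _
  intCast n := n • pieceOne F A
  intCast_ofNat _ := natCast_zsmul _ _
  intCast_negSucc_ofNat _ := negSucc_zsmul _ _

instance : DirectSum.GAlgebra F (Piece F A) where
  toFun := AddMonoidHom.mk' (fun c : F => c • pieceOne F A) fun a b => add_smul a b _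
  map_one := one_smul F _
  map_mul a b := by
    refine congrArg (GradedMonoid.mk 0) ?_
    change (a * b) • pieceOne F A = pieceMul F A (a • pieceOne F A) (b • pieceOne F A)
    rw [pieceMul_smul, mul_pieceOne, smul_smul, mul_comm]
  commutes c f := by
    have h : GradedMonoid.mk (0 + f.1) (pieceMul F A (c • pieceOne F A) f.2) =
        GradedMonoid.mk f.1 (pieceMul F A f.2 (c • pieceOne F A)) := by
      rw [smul_pieceMul, ← pieceMul_smul, mk_one_mul, pieceMul_smul, mul_pieceOne]
    exact h
  smul_def c f := by
    have h : GradedMonoid.mk f.1 (c • f.2) =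
        GradedMonoid.mk (0 + f.1) (pieceMul F A (c • pieceOne F A) f.2) := by
      rw [smul_pieceMul, ← pieceMul_smul, mk_one_mul]
    exact h

/-- The preprojective algebra `⨁_{r ≥ 0} Hom_A(A, τ^{-r} A)`. For `A = Λ` this is the left
preprojective algebra of `Λ`, for `A = Λᵐᵒᵖ` it is the right one. Its multiplication is
characterized by `of_mul_of'` below. -/
abbrev PreprojAlg : Type u := ⨁ r, Piece F A r

/-- The inclusion of the degree `r` part. -/
abbrev inDeg (r : ℕ) (f : Piece F A r) : PreprojAlg F A := DirectSum.of (Piece F A) r f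

theorem of_mul_of' {s r : ℕ} (g : Piece F A s) (f : Piece F A r) :
    inDeg F A s g * inDeg F A r f =
      inDeg F A (s + r) (f ≫ (tauPow F A r).map g ≫
        eqToHom (tauPow_obj F A s r (ModuleCat.of A A))) :=
  DirectSum.of_mul_of g f

/-- The left ideal `A e`, a direct summand of the regular left module `A` for `e` idempotent. For
`A = Λᵐᵒᵖ` it is the right ideal `e Λ` of `Λ`. -/
def proj (e : A) : ModuleCat.{u} A := ModuleCat.of A (Submodule.span A {e})

/-- The inclusion `A e → A`. -/
def projIncl (e : A) : proj A e ⟶ ModuleCat.of A A :=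
  ModuleCat.ofHom (Submodule.span A {e}).subtype

/-- The map `A → A e`, `x ↦ x e`. -/
def projRetr (e : A) : ModuleCat.of A A ⟶ proj A e :=
  ModuleCat.ofHom (LinearMap.toSpanSingleton A _ ⟨e, Submodule.mem_span_singleton_self e⟩)

/-- A map `A e → τ^{-r}(A e')`, viewed in `Hom_A(A, τ^{-r} A)` via the projection of `A` onto the
summand `A e` and the inclusion of the summand `A e'`. -/
def cornerIncl (r : ℕ) (e e' : A) (f : proj A e ⟶ (tauPow F A r).obj (proj A e')) :
    Piece F A r :=
  projRetr A e ≫ f ≫ (tauPow F A r).map (projIncl A e')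

end Translate

variable (F : Type u) [Field F] (Λ : Type u) [Ring Λ] [Algebra F Λ]

/-- An isomorphism of `Λ`-`Λ`-bimodules from `τ^{-r} Λ` formed with left modules to `τ^{-r} Λ` formed
with right modules. On the former `Λ` acts on the right, and on the latter on the left, by
functoriality. -/
structure BimoduleIso (r : ℕ) extends T F Λ r ≃+ T F Λᵐᵒᵖ r where
  map_left : ∀ (a : Λ) (x : T F Λ r), toFun (a • x) = rightAct F Λᵐᵒᵖ r (op a) (toFun x)
  map_right : ∀ (a : Λ) (x : T F Λ r), toFun (rightAct F Λ r a x) = op a • toFun x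

end

end Preproj

/-!
The functor `τ⁻ = Ext¹((-)*, A)` is right exact on finitely generated modules, because `Ext²`
vanishes over a hereditary algebra. Hence `τ⁻ M` has the universal property of `τ⁻A ⊗ M`, and
`⨁ Hom(A, τ^{-r} A)` that of the opposite of the tensor algebra of the bimodule `τ⁻A`: ring
homomorphisms out of it amount to compatible maps on its parts of degrees `0` and `1`.

The duality `Ext¹(X, Y) ≅ Ext¹(Y*, X*)`, together with `Λ** ≅ Λ`, identifies the bimodules `τ⁻Λ`
formed with left and with right modules. By the universal property, such an isomorphism `θ₁` extends
to anti-homomorphisms between the left and the right preprojective algebra in both directions, which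
are inverse to each other and graded since they are so in degrees `0` and `1`; their components are
the `θ_r`, unique for the same reason.
-/

theorem IsHereditary.of_ringEquiv {A B : Type u} [Ring A] [Ring B] (h : IsHereditary A)
    (e : A ≃+* B) : IsHereditary B := by
  intro M _ _ _ N
  have := RingHomInvPair.of_ringEquiv e
  have := RingHomInvPair.of_ringEquiv_symm e
  let := Module.compHom M (e : A →+* B)
  let restrictM : M ≃ₛₗ[(e : A →+* B)] M := { AddEquiv.refl M with map_smul' := fun _ _ => rfl }
  have : Module.Projective A M := .of_equiv restrictM.symm
  let N' : Submodule A M := { N with smul_mem' := fun a _ hx => N.smul_mem (e a) hx }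
  have : Module.Projective A N' := h M N'
  let restrictN : N' ≃ₛₗ[(e : A →+* B)] N :=
    { AddEquiv.refl N with map_smul' := fun _ _ => rfl }
  exact .of_equiv restrictN

namespace Preproj

noncomputable section

section Dual

variable {F : Type u} [Field F] {A : Type u} [Ring A] [Algebra F A]

instance (M : ModuleCat.{u} A) : FunLike (dualObj F A M) M F :=
  inferInstanceAs (FunLike (Module.Dual F M) M F)

/-- The underlying vector space of the right module `M*` is the dual space of `M`. -/
def dualEquiv (M : ModuleCat.{u} A) : dualObj F A M ≃ₗ[F] Module.Dual F M where
  __ := AddEquiv.refl (Module.Dual F M)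
  map_smul' c φ := LinearMap.ext fun m => map_smul (show Module.Dual F M from φ) c m

instance dualObj_finite (M : ModuleCat.{u} A) [Module.Finite F M] :
    Module.Finite F (dualObj F A M) :=
  .equiv (dualEquiv M).symm

/-- Restriction of scalars along the canonical isomorphism from `A` to its double opposite. -/
abbrev opOpRestrict (A : Type u) [Ring A] : ModuleCat.{u} Aᵐᵒᵖᵐᵒᵖ ⥤ ModuleCat.{u} A :=
  ModuleCat.restrictScalars (RingEquiv.opOp A : A →+* Aᵐᵒᵖᵐᵒᵖ)

/-- Maps `N → M*` and maps `M → N*` are both the balanced bilinear forms on `M × N`. -/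
def transposeEquiv (M : ModuleCat.{u} A) (N : ModuleCat.{u} Aᵐᵒᵖ) :
    (N ⟶ dualObj F A M) ≃ (M ⟶ (opOpRestrict A).obj (dualObj F Aᵐᵒᵖ N)) where
  toFun f := ModuleCat.ofHom (Y := (opOpRestrict A).obj (dualObj F Aᵐᵒᵖ N))
    { toFun := fun m => (dualEquiv N).symm
        (((dualEquiv M).toLinearMap ∘ₗ f.hom.restrictScalars F).flip m)
      map_add' := fun m m' => LinearMap.ext fun n => map_add (dualEquiv M (f n)) m m'
      map_smul' := fun a m => LinearMap.ext fun n =>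
        (congrArg (fun φ : dualObj F A M => φ m) (map_smul f.hom (op a) n)).symm }
  invFun g := ModuleCat.ofHom (Y := dualObj F A M)
    { toFun := fun n => (dualEquiv M).symm
        { toFun := fun m => (show dualObj F Aᵐᵒᵖ N from g m) n
          map_add' := fun m m' => congrArg (fun φ : dualObj F Aᵐᵒᵖ N => φ n) (map_add g.hom m m')
          map_smul' := fun c m =>
            (congrArg (fun φ : dualObj F Aᵐᵒᵖ N => φ n) (map_smul g.hom (algebraMap F A c) m)).trans
              (map_smul (dualEquiv N (g m)) c n) }
      map_add' := fun n n' => LinearMap.ext fun m => map_add (dualEquiv N (g m)) n n'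
      map_smul' := fun a n => LinearMap.ext fun m =>
        (congrArg (fun φ : dualObj F Aᵐᵒᵖ N => φ n) (map_smul g.hom a.unop m)).symm }
  left_inv _ := rfl
  right_inv _ := rfl

/-- The evaluation map `M → M**`. -/
def evalHom (F : Type u) [Field F] {A : Type u} [Ring A] [Algebra F A] (M : ModuleCat.{u} A) :
    M ⟶ (opOpRestrict A).obj (dualObj F Aᵐᵒᵖ (dualObj F A M)) :=
  transposeEquiv M (dualObj F A M) (𝟙 _)

theorem evalHom_injective (M : ModuleCat.{u} A) : Function.Injective (evalHom F M) :=
  fun _ _ h => Module.eval_apply_injective F <| LinearMap.ext fun φ =>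
    LinearMap.congr_fun h ((dualEquiv M).symm φ)

theorem evalHom_bijective (M : ModuleCat.{u} A) [Module.Finite F M] :
    Function.Bijective (evalHom F M) := by
  refine ⟨evalHom_injective M, fun ξ => ?_⟩
  obtain ⟨m, hm⟩ := (Module.evalEquiv F M).surjective
    (dualEquiv (dualObj F A M) ξ ∘ₗ (dualEquiv M).symm.toLinearMap)
  exact ⟨m, LinearMap.ext fun φ => LinearMap.congr_fun hm (dualEquiv M φ)⟩

theorem dualMap_injective (M N : ModuleCat.{u} A) :
    Function.Injective (dualMap F A : (M ⟶ N) → _) := fun f g h => by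
  have := (ModuleCat.mono_iff_injective _).2 (evalHom_injective (F := F) N)
  have := congrArg (transposeEquiv M (dualObj F A N)) h
  exact (cancel_mono (evalHom F N)).1 this

theorem dualMap_surjective (M N : ModuleCat.{u} A) [Module.Finite F N] :
    Function.Surjective (dualMap F A : (M ⟶ N) → _) := fun f => by
  have := (ConcreteCategory.isIso_iff_bijective _).2 (evalHom_bijective (F := F) N)
  refine ⟨transposeEquiv M _ f ≫ inv (evalHom F N), (transposeEquiv M _).injective ?_⟩
  change (transposeEquiv M _ f ≫ inv (evalHom F N)) ≫ evalHom F N = transposeEquiv M _ f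
  simp

/-- The dual of a short complex. -/
def dualComplex (F : Type u) [Field F] {A : Type u} [Ring A] [Algebra F A]
    (S : ShortComplex (ModuleCat.{u} A)) : ShortComplex (ModuleCat.{u} Aᵐᵒᵖ) :=
  ShortComplex.mk (dualMap F A S.g) (dualMap F A S.f) (by
    rw [← dualMap_comp, S.zero]
    exact ModuleCat.hom_ext (LinearMap.ext fun φ => LinearMap.comp_zero (dualEquiv _ φ)))

theorem dualMap_injective_iff {M N : ModuleCat.{u} A} {f : M ⟶ N} :
    Function.Injective (dualMap F A f) ↔ Function.Surjective f :=
  LinearMap.dualMap_injective_iff (f := f.hom.restrictScalars F)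

theorem dualMap_surjective_iff {M N : ModuleCat.{u} A} {f : M ⟶ N} :
    Function.Surjective (dualMap F A f) ↔ Function.Injective f :=
  LinearMap.dualMap_surjective_iff (f := f.hom.restrictScalars F)

theorem dualComplex_shortExact {S : ShortComplex (ModuleCat.{u} A)} (hS : S.ShortExact) :
    (dualComplex F S).ShortExact where
  exact := by
    rw [ShortComplex.ShortExact.moduleCat_exact_iff_function_exact]
    let f := S.f.hom.restrictScalars F
    let g := S.g.hom.restrictScalars F
    have ker_g : LinearMap.ker g = LinearMap.range f :=
      SetLike.ext ((ShortComplex.ShortExact.moduleCat_exact_iff_function_exact S).1 hS.exact)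
    have ker_dual : LinearMap.ker f.dualMap = LinearMap.range g.dualMap := by
      rw [f.ker_dualMap_eq_dualAnnihilator_range, g.range_dualMap_eq_dualAnnihilator_ker, ker_g]
    exact SetLike.ext_iff.1 ker_dual
  mono_f := (ModuleCat.mono_iff_injective _).2 <| dualMap_injective_iff.2 <|
    (ModuleCat.epi_iff_surjective _).1 hS.epi_g
  epi_g := (ModuleCat.epi_iff_surjective _).2 <| dualMap_surjective_iff.2 <|
    (ModuleCat.mono_iff_injective _).1 hS.mono_f

instance dualObj_injective (P : ModuleCat.{u} A) [Projective P] : Injective (dualObj F A P) where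
  factors {N M} f i hi := by
    have : Epi (dualMap F Aᵐᵒᵖ i) := (ModuleCat.epi_iff_surjective _).2 <|
      dualMap_surjective_iff.2 <| (ModuleCat.mono_iff_injective _).1 hi
    have : Epi ((opOpRestrict A).map (dualMap F Aᵐᵒᵖ i)) := inferInstance
    let lift := Projective.factorThru (transposeEquiv P N f)
      ((opOpRestrict A).map (dualMap F Aᵐᵒᵖ i))
    have lift_comp : lift ≫ (opOpRestrict A).map (dualMap F Aᵐᵒᵖ i) = transposeEquiv P N f :=
      Projective.factorThru_comp _ _
    exact ⟨(transposeEquiv P M).symm lift, (transposeEquiv P N).injective lift_comp⟩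

end Dual

section Hereditary

theorem hasProjectiveDimensionLE_one_of_isHereditary {A : Type u} [Ring A] (h : IsHereditary A)
    (X : ModuleCat.{u} A) : HasProjectiveDimensionLE X 1 := by
  have : Module.Projective A X.projectiveShortComplex.X₁ :=
    h X.projectiveShortComplex.X₂ (LinearMap.ker X.projectiveShortComplex.g.hom)
  exact (X.shortExact_projectiveShortComplex.hasProjectiveDimensionLT_X₃_iff 0
    inferInstance).2 (projective_iff_hasProjectiveDimensionLT_one.1 inferInstance)

theorem hasInjectiveDimensionLE_one_of_isHereditary {A : Type u} [Ring A] (h : IsHereditary A)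
    (X : ModuleCat.{u} A) : HasInjectiveDimensionLE X 1 := by
  refine (hasInjectiveDimensionLT_iff X 2).2 fun i hi Y e => ?_
  have := hasProjectiveDimensionLE_one_of_isHereditary h Y
  exact e.eq_zero_of_hasProjectiveDimensionLT 2 hi

theorem exists_projective_surjective {A : Type u} [Ring A] (X : ModuleCat.{u} A)
    [Module.Finite A X] : ∃ (P : ModuleCat.{u} A) (π : P ⟶ X),
      Projective P ∧ Module.Finite A P ∧ Function.Surjective π := by
  obtain ⟨n, f, hf⟩ := Module.Finite.exists_fin' A X
  exact ⟨ModuleCat.of A (Fin n → A), ModuleCat.ofHom f,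
    (IsProjective.iff_projective (R := A) (Fin n → A)).1 inferInstance,
    inferInstanceAs (Module.Finite A (Fin n → A)), hf⟩

variable (F : Type u) [Field F] {A : Type u} [Ring A] [Algebra F A] [FiniteDimensional F A]

theorem finiteDimensional_of_finite (X : ModuleCat.{u} A) [Module.Finite A X] : Module.Finite F X :=
  .trans A X

theorem projective_of_injective_dualObj (X : ModuleCat.{u} A) [Module.Finite A X]
    [Injective (dualObj F A X)] : Projective X := by
  obtain ⟨P, π, _, _, hπ⟩ := exists_projective_surjective X
  have := finiteDimensional_of_finite F P
  have : Mono (dualMap F A π) := (ModuleCat.mono_iff_injective _).2 (dualMap_injective_iff.2 hπ)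
  obtain ⟨s, hs⟩ := dualMap_surjective X P (Injective.factorThru (𝟙 _) (dualMap F A π))
  have split : s ≫ π = 𝟙 X := dualMap_injective (F := F) X X (by
    rw [dualMap_comp, hs, Injective.comp_factorThru, dualMap_id])
  exact (Retract.mk s π split).projective

include F in
/-- `X*` has injective dimension at most one because right modules have projective dimension at most
one; dualizing back bounds the projective dimension of `X`. -/
theorem hasProjectiveDimensionLE_one_of_isHereditary_op (h : IsHereditary Aᵐᵒᵖ)
    (X : ModuleCat.{u} A) [Module.Finite A X] : HasProjectiveDimensionLE X 1 := by
  have : IsNoetherianRing A := .of_finite F A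
  obtain ⟨P, π, _, _, hπ⟩ := exists_projective_surjective X
  have hS := LinearMap.shortExact_shortComplexKer hπ
  let S := π.hom.shortComplexKer
  have injective_X₂ : HasInjectiveDimensionLT (dualObj F A P) 1 :=
    injective_iff_hasInjectiveDimensionLT_one.1 inferInstance
  have : Injective (dualObj F A S.X₁) := injective_iff_hasInjectiveDimensionLT_one.2 <|
    (dualComplex_shortExact (F := F) hS).hasInjectiveDimensionLT_X₃ 1 injective_X₂
      (hasInjectiveDimensionLE_one_of_isHereditary h _)
  have : Module.Finite A S.X₁ := inferInstanceAs (Module.Finite A (LinearMap.ker π.hom))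
  have : Projective S.X₁ := projective_of_injective_dualObj F S.X₁
  exact (hS.hasProjectiveDimensionLT_X₃_iff 0 ‹Projective P›).2
    (projective_iff_hasProjectiveDimensionLT_one.1 this)

end Hereditary

section RightExact

/-- A functor between module categories sending short exact sequences that start with a finitely
generated module to right exact sequences. -/
def RightExactOnFinite {A B : Type u} [Ring A] [Ring B]
    (G : ModuleCat.{u} A ⥤ ModuleCat.{u} B) : Prop :=
  ∀ S : ShortComplex (ModuleCat.{u} A), S.ShortExact → Module.Finite A S.X₁ →
    Function.Surjective (G.map S.g) ∧ Function.Exact (G.map S.f) (G.map S.g)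

section FiniteDimensional

variable {F : Type u} [Field F] {A : Type u} [Ring A] [Algebra F A]

theorem rightExactOnFinite_tauMinus_of_hasProjectiveDimensionLE [FiniteDimensional F A]
    (h : ∀ (X : ModuleCat.{u} Aᵐᵒᵖ) [Module.Finite Aᵐᵒᵖ X], HasProjectiveDimensionLE X 1) :
    RightExactOnFinite (tauMinus F A) := by
  intro S hS _
  have hD := dualComplex_shortExact (F := F) hS
  have := finiteDimensional_of_finite F S.X₁
  have : Module.Finite Aᵐᵒᵖ (dualObj F A S.X₁) := .of_restrictScalars_finite F Aᵐᵒᵖ _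
  have : HasProjectiveDimensionLE (dualComplex F S).X₃ 1 := h (dualObj F A S.X₁)
  refine ⟨fun x => ?_, fun y => ⟨fun hy => ?_, ?_⟩⟩
  · exact Ext.contravariant_sequence_exact₁ hD (rightRegular A) (n₀ := 1) x (n₁ := 2) rfl
      (Ext.eq_zero_of_hasProjectiveDimensionLT _ 2 le_rfl)
  · exact Ext.contravariant_sequence_exact₂ hD (rightRegular A) (n := 1) y hy
  · rintro ⟨x, rfl⟩
    rw [← ModuleCat.comp_apply, ← Functor.map_comp, S.zero, Functor.map_zero]
    rfl

theorem rightExactOnFinite_tauMinus [FiniteDimensional F A] (h : IsHereditary A) :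
    RightExactOnFinite (tauMinus F A) :=
  rightExactOnFinite_tauMinus_of_hasProjectiveDimensionLE fun X _ =>
    hasProjectiveDimensionLE_one_of_isHereditary_op F (h.of_ringEquiv (RingEquiv.opOp A)) X

theorem rightExactOnFinite_tauMinus_op [FiniteDimensional F A] (h : IsHereditary A) :
    RightExactOnFinite (tauMinus F Aᵐᵒᵖ) :=
  rightExactOnFinite_tauMinus_of_hasProjectiveDimensionLE fun X _ =>
    hasProjectiveDimensionLE_one_of_isHereditary (h.of_ringEquiv (RingEquiv.opOp A)) X

theorem finite_hom (X Y : ModuleCat.{u} A) [Module.Finite F X] [Module.Finite F Y] :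
    Module.Finite F (X ⟶ Y) :=
  .of_injective
    (LinearMap.restrictScalarsₗ F A X Y F ∘ₗ (ModuleCat.homLinearEquiv (S := F)).toLinearMap)
    ((LinearMap.restrictScalars_injective F).comp ModuleCat.homLinearEquiv.injective)

theorem finite_ext_one [FiniteDimensional F A] (X Y : ModuleCat.{u} A) [Module.Finite A X]
    [Module.Finite F Y] : Module.Finite F (Ext X Y 1) := by
  obtain ⟨P, π, _, _, hπ⟩ := exists_projective_surjective X
  have hS := LinearMap.shortExact_shortComplexKer hπ
  let K := ModuleCat.of A (LinearMap.ker π.hom)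
  have : IsNoetherianRing A := .of_finite F A
  have : Module.Finite F K := finiteDimensional_of_finite F K
  have := finite_hom (F := F) K Y
  exact .of_surjective
    (hS.extClass.precompOfLinear F Y (add_zero 1) ∘ₗ (Ext.linearEquiv₀ (R := F)).symm.toLinearMap)
    ((precomp_extClass_surjective_of_projective_X₂ Y hS 0).comp (LinearEquiv.surjective _))

instance [FiniteDimensional F A] : Module.Finite F (rightRegular A) :=
  let e : A ≃ₗ[F] rightRegular A :=
    { AddEquiv.refl A with
      map_smul' := fun c x => (Algebra.smul_def c x).trans (Algebra.commutes c x) }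
  .equiv e

theorem finite_tauMinus [FiniteDimensional F A] (M : ModuleCat.{u} A) [Module.Finite A M] :
    Module.Finite A ((tauMinus F A).obj M) := by
  have := finiteDimensional_of_finite F M
  have : Module.Finite Aᵐᵒᵖ (dualObj F A M) := .of_restrictScalars_finite F Aᵐᵒᵖ _
  have := finite_ext_one (F := F) (dualObj F A M) (rightRegular A)
  let e : TauGroup F A M ≃ₗ[F] (tauMinus F A).obj M :=
    { AddEquiv.refl (TauGroup F A M) with
      map_smul' := fun c x => by
        change c • x = x.comp (Ext.mk₀ (lmul A (algebraMap F A c))) (add_zero 1)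
        rw [lmul_algebraMap, ← Ext.smul_eq_comp_mk₀] }
  have : Module.Finite F ((tauMinus F A).obj M) := .equiv e
  exact .of_restrictScalars_finite F A _

end FiniteDimensional

section Elements

variable {A : Type u} [Ring A]

/-- Elements `m` of `M` correspond to maps `A → M`, `a ↦ a m`. -/
def elemMap {M : ModuleCat.{u} A} : M ≃+ (ModuleCat.of A A ⟶ M) where
  toFun m := ModuleCat.ofHom (LinearMap.toSpanSingleton A M m)
  invFun f := f (1 : A)
  left_inv m := one_smul A m
  right_inv f := ModuleCat.hom_ext (LinearMap.ext_ring (one_smul A (f (1 : A))))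
  map_add' m n := ModuleCat.hom_ext (LinearMap.ext fun a => smul_add a m n)

theorem elemMap_comp {M N : ModuleCat.{u} A} (m : M) (f : M ⟶ N) :
    elemMap m ≫ f = elemMap (f m) :=
  ModuleCat.hom_ext (LinearMap.ext fun a => map_smul f.hom a m)

theorem elemMap_smul {M : ModuleCat.{u} A} (a : A) (m : M) :
    elemMap (a • m) = rmul A a ≫ elemMap m :=
  (elemMap_comp (M := ModuleCat.of A A) a (elemMap m)).symm

theorem sum_smul_map_single {ι M : Type*} [Fintype ι] [DecidableEq ι] [AddCommGroup M] [Module A M]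
    (f : (ι → A) →ₗ[A] M) (p : ι → A) : ∑ i, p i • f (Pi.single i 1) = f p := by
  simp_rw [← map_smul, ← map_sum, ← Pi.single_smul, smul_eq_mul, mul_one, Finset.univ_sum_single]

end Elements

section EilenbergWatts

variable {A B : Type u} [Ring A] [Ring B] {G : ModuleCat.{u} A ⥤ ModuleCat.{u} B} [G.Additive]
  {X : Type*} [AddCommGroup X]

theorem map_ofHom_eq_sum {n : ℕ} {M : ModuleCat.{u} A} (f : (Fin n → A) →ₗ[A] M)
    (y : G.obj (ModuleCat.of A (Fin n → A))) :
    G.map (ModuleCat.ofHom f) y = ∑ i, G.map (elemMap (f (Pi.single i 1)))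
      (G.map (ModuleCat.ofHom (LinearMap.proj i)) y) := by
  have decomposition : ModuleCat.ofHom f =
      ∑ i, ModuleCat.ofHom (LinearMap.proj i) ≫ elemMap (f (Pi.single i 1)) := by
    refine ModuleCat.hom_ext (LinearMap.ext fun p => ?_)
    rw [ModuleCat.hom_sum, LinearMap.sum_apply]
    exact (sum_smul_map_single f p).symm
  rw [decomposition, G.map_sum]
  change (ModuleCat.Hom.hom _) y = _
  rw [ModuleCat.hom_sum, LinearMap.sum_apply]
  simp only [G.map_comp, ModuleCat.hom_comp, LinearMap.comp_apply]

variable (hG : RightExactOnFinite G) [IsNoetherianRing A]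
include hG

theorem RightExactOnFinite.addHom_ext {M : ModuleCat.{u} A} [Module.Finite A M]
    {γ γ' : G.obj M →+ X}
    (h : ∀ (m : M) (x : G.obj (ModuleCat.of A A)),
      γ (G.map (elemMap m) x) = γ' (G.map (elemMap m) x)) : γ = γ' := by
  obtain ⟨n, f, hf⟩ := Module.Finite.exists_fin' A M
  ext z
  obtain ⟨y, rfl⟩ := (hG _ (LinearMap.shortExact_shortComplexKer hf) inferInstance).1 z
  simp only [map_ofHom_eq_sum, map_sum, h]

/-- `G M` has the universal property of the tensor product `G A ⊗ M`. -/
theorem RightExactOnFinite.exists_lift {M : ModuleCat.{u} A} [Module.Finite A M]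
    (β : G.obj (ModuleCat.of A A) →+ M →+ X)
    (hβ : ∀ (x : G.obj (ModuleCat.of A A)) (a : A) (m : M),
      β (G.map (rmul A a) x) m = β x (a • m)) :
    ∃ γ : G.obj M →+ X, ∀ (m : M) (x : G.obj (ModuleCat.of A A)),
      γ (G.map (elemMap m) x) = β x m := by
  obtain ⟨n, f, hf⟩ := Module.Finite.exists_fin' A M
  obtain ⟨map_surjective, map_exact⟩ := hG _ (LinearMap.shortExact_shortComplexKer hf) inferInstance
  let γ' : G.obj (ModuleCat.of A (Fin n → A)) →+ X := ∑ i, (β.flip (f (Pi.single i 1))).comp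
    (G.map (ModuleCat.ofHom (LinearMap.proj (φ := fun _ => A) i))).hom.toAddMonoidHom
  have γ'_map (p : ModuleCat.of A (Fin n → A)) (x : G.obj (ModuleCat.of A A)) :
      γ' (G.map (elemMap p) x) = β x (f p) := by
    have coordinate (i : Fin n) :
        elemMap p ≫ ModuleCat.ofHom (LinearMap.proj i) = rmul A ((p : Fin n → A) i) :=
      elemMap_comp p _
    calc γ' (G.map (elemMap p) x)
        = ∑ i, β (G.map (rmul A ((p : Fin n → A) i)) x) (f (Pi.single i 1)) := by
          simp [γ', ← coordinate]
      _ = β x (f p) := by simp only [hβ, ← map_sum, sum_smul_map_single]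
  have γ'_ker :
      γ'.comp (G.map (ModuleCat.ofHom (LinearMap.ker f).subtype)).hom.toAddMonoidHom = 0 := by
    refine hG.addHom_ext fun k x => ?_
    change γ' (G.map _ (G.map (elemMap k) x)) = 0
    rw [← ModuleCat.comp_apply, ← G.map_comp, elemMap_comp, γ'_map]
    exact (congrArg (β x) k.2).trans (map_zero _)
  have ker_le : (G.map (ModuleCat.ofHom f)).hom.toAddMonoidHom.ker ≤ γ'.ker := by
    intro y hy
    obtain ⟨x, rfl⟩ := (map_exact y).1 hy
    exact DFunLike.congr_fun γ'_ker x
  refine ⟨(G.map (ModuleCat.ofHom f)).hom.toAddMonoidHom.liftOfSurjective map_surjective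
    ⟨γ', ker_le⟩, fun m x => ?_⟩
  obtain ⟨p, rfl⟩ := hf m
  have factor : elemMap (f p) = elemMap (M := ModuleCat.of A (Fin n → A)) p ≫ ModuleCat.ofHom f :=
    (elemMap_comp (M := ModuleCat.of A (Fin n → A)) p (ModuleCat.ofHom f)).symm
  rw [← γ'_map, factor, G.map_comp, ModuleCat.comp_apply]
  exact AddMonoidHom.liftOfRightInverse_comp_apply _ _ _ _ _

end EilenbergWatts

end RightExact

section ExtDuality

variable {F : Type u} [Field F] {A : Type u} [Ring A] [Algebra F A]

theorem exists_addEquiv_of_ker_eq {G H H' : Type*} [AddCommGroup G] [AddCommGroup H]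
    [AddCommGroup H'] {δ : G →+ H} {δ' : G →+ H'} (hδ : Function.Surjective δ)
    (hδ' : Function.Surjective δ') (h : ∀ x, δ x = 0 ↔ δ' x = 0) :
    ∃ e : H ≃+ H', ∀ x, e (δ x) = δ' x := by
  have ker_eq : δ.ker = δ'.ker := AddSubgroup.ext h
  refine ⟨(QuotientAddGroup.quotientKerEquivOfSurjective δ hδ).symm.trans
    ((QuotientAddGroup.quotientAddEquivOfEq ker_eq).trans
      (QuotientAddGroup.quotientKerEquivOfSurjective δ' hδ')), fun x => ?_⟩
  rw [AddEquiv.trans_apply, (AddEquiv.symm_apply_eq _).2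
    (show δ x = QuotientAddGroup.quotientKerEquivOfSurjective δ hδ x from rfl)]
  rfl

theorem extClass_comp_eq_zero_iff {S : ShortComplex (ModuleCat.{u} A)} (hS : S.ShortExact)
    {Y : ModuleCat.{u} A} {f : S.X₁ ⟶ Y} :
    hS.extClass.comp (Ext.mk₀ f) (add_zero 1) = 0 ↔ ∃ g : S.X₂ ⟶ Y, S.f ≫ g = f := by
  constructor
  · intro hf
    obtain ⟨y, hy⟩ := Ext.contravariant_sequence_exact₁ hS Y (Ext.mk₀ f) (n₁ := 1) rfl hf
    obtain ⟨g, rfl⟩ := (Ext.mk₀_bijective _ _).2 y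
    rw [Ext.mk₀_comp_mk₀] at hy
    exact ⟨g, (Ext.mk₀_bijective _ _).1 hy⟩
  · rintro ⟨g, rfl⟩
    rw [← Ext.mk₀_comp_mk₀, hS.extClass_comp_assoc]

theorem comp_extClass_eq_zero_iff {S : ShortComplex (ModuleCat.{u} A)} (hS : S.ShortExact)
    {Y : ModuleCat.{u} A} {f : Y ⟶ S.X₃} :
    (Ext.mk₀ f).comp hS.extClass (zero_add 1) = 0 ↔ ∃ g : Y ⟶ S.X₂, g ≫ S.g = f := by
  constructor
  · intro hf
    obtain ⟨y, hy⟩ := Ext.covariant_sequence_exact₃ Y hS (Ext.mk₀ f) (n₁ := 1) rfl hf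
    obtain ⟨g, rfl⟩ := (Ext.mk₀_bijective _ _).2 y
    rw [Ext.mk₀_comp_mk₀] at hy
    exact ⟨g, (Ext.mk₀_bijective _ _).1 hy⟩
  · rintro ⟨g, rfl⟩
    rw [← Ext.mk₀_comp_mk₀_assoc, hS.comp_extClass, Ext.comp_zero]

variable (F) in
/-- The class in `Ext¹(X₁*, X₃*)` of the dual of a short exact sequence. -/
def dualExtClass {S : ShortComplex (ModuleCat.{u} A)} (hS : S.ShortExact) :
    Ext (dualObj F A S.X₁) (dualObj F A S.X₃) 1 :=
  (dualComplex_shortExact hS).extClass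

theorem dualExtClass_naturality {S S' : ShortComplex (ModuleCat.{u} A)} (hS : S.ShortExact)
    (hS' : S'.ShortExact) (φ : S ⟶ S') :
    (dualExtClass F hS').comp (Ext.mk₀ (dualMap F A φ.τ₃)) (add_zero 1) =
      (Ext.mk₀ (dualMap F A φ.τ₁)).comp (dualExtClass F hS) (zero_add 1) :=
  ShortComplex.ShortExact.extClass_naturality (dualComplex_shortExact hS')
    (dualComplex_shortExact hS)
    ⟨dualMap F A φ.τ₃, dualMap F A φ.τ₂, dualMap F A φ.τ₁,
      congrArg (dualMap F A) φ.comm₂₃.symm, congrArg (dualMap F A) φ.comm₁₂.symm⟩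

/-- Both kernels consist of the maps that extend along `S.f`. -/
theorem extClass_comp_eq_zero_iff_dual {S : ShortComplex (ModuleCat.{u} A)} (hS : S.ShortExact)
    {Y : ModuleCat.{u} A} [Module.Finite F Y] (f : S.X₁ ⟶ Y) :
    hS.extClass.comp (Ext.mk₀ f) (add_zero 1) = 0 ↔
      (Ext.mk₀ (dualMap F A f)).comp (dualExtClass F hS) (zero_add 1) = 0 := by
  have lift_iff : (Ext.mk₀ (dualMap F A f)).comp (dualExtClass F hS) (zero_add 1) = 0 ↔
      ∃ g : dualObj F A Y ⟶ dualObj F A S.X₂, g ≫ dualMap F A S.f = dualMap F A f :=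
    comp_extClass_eq_zero_iff (dualComplex_shortExact hS)
  rw [extClass_comp_eq_zero_iff, lift_iff, (dualMap_surjective S.X₂ Y).exists]
  exact exists_congr fun g => (dualMap_injective S.X₁ Y).eq_iff.symm

theorem exists_extClass_comp_eq {S : ShortComplex (ModuleCat.{u} A)} (hS : S.ShortExact)
    [Projective S.X₂] {Y : ModuleCat.{u} A} (x : Ext S.X₃ Y 1) :
    ∃ f : S.X₁ ⟶ Y, hS.extClass.comp (Ext.mk₀ f) (add_zero 1) = x :=
  ((precomp_extClass_surjective_of_projective_X₂ Y hS 0).comp Ext.addEquiv₀.symm.surjective) x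

theorem exists_extDualEquiv {S : ShortComplex (ModuleCat.{u} A)} (hS : S.ShortExact)
    [Projective S.X₂] (Y : ModuleCat.{u} A) [Module.Finite F Y] :
    ∃ Φ : Ext S.X₃ Y 1 ≃+ Ext (dualObj F A Y) (dualObj F A S.X₃) 1, ∀ f : S.X₁ ⟶ Y,
      Φ (hS.extClass.comp (Ext.mk₀ f) (add_zero 1)) =
        (Ext.mk₀ (dualMap F A f)).comp (dualExtClass F hS) (zero_add 1) := by
  have hD := dualComplex_shortExact (F := F) hS
  have : Injective (dualComplex F S).X₂ := dualObj_injective S.X₂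
  let dual : (S.X₁ ⟶ Y) →+ (dualObj F A Y ⟶ dualObj F A S.X₁) :=
    AddMonoidHom.mk' (dualMap F A) (dualMap_add F A)
  let δ : (S.X₁ ⟶ Y) →+ Ext S.X₃ Y 1 :=
    (hS.extClass.precomp Y (add_zero 1)).comp Ext.addEquiv₀.symm.toAddMonoidHom
  let δ' : (S.X₁ ⟶ Y) →+ Ext (dualObj F A Y) (dualObj F A S.X₃) 1 :=
    (hD.extClass.postcomp (dualObj F A Y) (zero_add 1)).comp
      (Ext.addEquiv₀.symm.toAddMonoidHom.comp dual)
  exact exists_addEquiv_of_ker_eq (δ := δ) (δ' := δ')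
    (exists_extClass_comp_eq hS)
    ((postcomp_extClass_surjective_of_projective_X₂ hD (dualObj F A Y) 0).comp
      (Ext.addEquiv₀.symm.surjective.comp (dualMap_surjective S.X₁ Y)))
    (extClass_comp_eq_zero_iff_dual hS)

theorem exists_hom_extending {S : ShortComplex (ModuleCat.{u} A)} (hS : S.ShortExact)
    [Projective S.X₂] (b : S.X₃ ⟶ S.X₃) : ∃ φ : S ⟶ S, φ.τ₃ = b := by
  have := hS.epi_g
  have := hS.mono_f
  let c : S.X₂ ⟶ S.X₂ := Projective.factorThru (S.g ≫ b) S.g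
  have hc : c ≫ S.g = S.g ≫ b := Projective.factorThru_comp _ _
  have comp_eq_zero : (S.f ≫ c) ≫ S.g = 0 := by
    rw [Category.assoc, hc, S.zero_assoc, Limits.zero_comp]
  exact ⟨⟨hS.exact.lift (S.f ≫ c) comp_eq_zero, c, b, hS.exact.lift_f _ _, hc⟩, rfl⟩

theorem exists_natural_extDualEquiv (X Y : ModuleCat.{u} A) [Module.Finite F Y] :
    ∃ Φ : Ext X Y 1 ≃+ Ext (dualObj F A Y) (dualObj F A X) 1,
      (∀ (a : Y ⟶ Y) (x : Ext X Y 1), Φ (x.comp (Ext.mk₀ a) (add_zero 1)) =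
        (Ext.mk₀ (dualMap F A a)).comp (Φ x) (zero_add 1)) ∧
      ∀ (b : X ⟶ X) (x : Ext X Y 1), Φ ((Ext.mk₀ b).comp x (zero_add 1)) =
        (Φ x).comp (Ext.mk₀ (dualMap F A b)) (add_zero 1) := by
  obtain ⟨S, hS, _, rfl⟩ : ∃ S : ShortComplex (ModuleCat.{u} A),
      S.ShortExact ∧ Projective S.X₂ ∧ S.X₃ = X :=
    ⟨_, LinearMap.shortExact_shortComplexKer
      ((ModuleCat.epi_iff_surjective (Projective.π X)).1 inferInstance),
      Projective.projective_over X, rfl⟩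
  obtain ⟨Φ, hΦ⟩ := exists_extDualEquiv (F := F) hS Y
  refine ⟨Φ, fun a x => ?_, fun b x => ?_⟩
  · obtain ⟨f, rfl⟩ := exists_extClass_comp_eq hS x
    rw [Ext.comp_assoc_of_third_deg_zero, Ext.mk₀_comp_mk₀, hΦ, hΦ, dualMap_comp,
      Ext.mk₀_comp_mk₀_assoc]
  · obtain ⟨f, rfl⟩ := exists_extClass_comp_eq hS x
    obtain ⟨φ, rfl⟩ := exists_hom_extending hS b
    rw [← Ext.comp_assoc_of_third_deg_zero,
      ← ShortComplex.ShortExact.extClass_naturality hS hS φ, Ext.comp_assoc_of_third_deg_zero,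
      Ext.mk₀_comp_mk₀, hΦ, hΦ, dualMap_comp, ← Ext.mk₀_comp_mk₀_assoc, ← dualExtClass_naturality,
      Ext.comp_assoc_of_third_deg_zero]

variable (F) in
/-- Duality applied to an isomorphism. -/
def dualIso {M N : ModuleCat.{u} A} (e : M ≅ N) : dualObj F A N ≅ dualObj F A M where
  hom := dualMap F A e.hom
  inv := dualMap F A e.inv
  hom_inv_id := by rw [← dualMap_comp, e.inv_hom_id, dualMap_id]
  inv_hom_id := by rw [← dualMap_comp, e.hom_inv_id, dualMap_id]

/-- The regular right `A`-module is the regular left module over the opposite ring. -/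
def rightRegularIso (A : Type u) [Ring A] : rightRegular A ≅ ModuleCat.of Aᵐᵒᵖ Aᵐᵒᵖ :=
  LinearEquiv.toModuleIso (X₁ := A) { opAddEquiv with map_smul' := fun _ _ => rfl }

/-- The evaluation isomorphism `A ≅ A**` of right `Aᵐᵒᵖ`-modules. -/
def doubleDualIso (F A : Type u) [Field F] [Ring A] [Algebra F A] [FiniteDimensional F A] :
    rightRegular Aᵐᵒᵖ ≅ dualObj F Aᵐᵒᵖ (dualObj F A (ModuleCat.of A A)) :=
  have := finiteDimensional_of_finite F (ModuleCat.of A A)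
  LinearEquiv.toModuleIso (X₁ := Aᵐᵒᵖ) <| LinearEquiv.ofBijective
    { toFun := fun x => evalHom F (ModuleCat.of A A) (unop x)
      map_add' := fun x y => map_add (evalHom F (ModuleCat.of A A)).hom (unop x) (unop y)
      map_smul' := fun _ _ => rfl }
    ((evalHom_bijective (F := F) (ModuleCat.of A A)).comp unop_bijective)

theorem nonempty_bimoduleIso_one [FiniteDimensional F A] : Nonempty (BimoduleIso F A 1) := by
  obtain ⟨Φ, Φ_comp, Φ_precomp⟩ := exists_natural_extDualEquiv (F := F)
    (dualObj F A (ModuleCat.of A A)) (rightRegular A)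
  let p := dualIso F (rightRegularIso A)
  let q := (doubleDualIso F A).symm
  let e : Ext (dualObj F Aᵐᵒᵖ (rightRegular A))
        (dualObj F Aᵐᵒᵖ (dualObj F A (ModuleCat.of A A))) 1 ≃+
      Ext (dualObj F Aᵐᵒᵖ (ModuleCat.of Aᵐᵒᵖ Aᵐᵒᵖ)) (rightRegular Aᵐᵒᵖ) 1 :=
    (((extFunctor 1).mapIso p.op).app _ ≪≫
      (extFunctorObj _ 1).mapIso q).addCommGroupIsoToAddEquiv
  have e_apply (x) : e x =
      ((Ext.mk₀ p.hom).comp x (zero_add 1)).comp (Ext.mk₀ q.hom) (add_zero 1) := rfl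
  have p_comm (a : A) : p.hom ≫ dualMap F Aᵐᵒᵖ (lmul A a) =
      dualMap F Aᵐᵒᵖ (rmul Aᵐᵒᵖ (op a)) ≫ p.hom := rfl
  have q_comm (a : A) : dualMap F Aᵐᵒᵖ (dualMap F A (rmul A a)) ≫ q.hom =
      q.hom ≫ lmul Aᵐᵒᵖ (op a) := by
    rw [← q.inv_comp_eq, ← Category.assoc, ← q.eq_comp_inv]
    rfl
  have map_left (a : A) (x : TauGroup F A (ModuleCat.of A A)) :
      e (Φ (x.comp (Ext.mk₀ (lmul A a)) (add_zero 1))) =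
        (Ext.mk₀ (dualMap F Aᵐᵒᵖ (rmul Aᵐᵒᵖ (op a)))).comp (e (Φ x)) (zero_add 1) := by
    rw [Φ_comp, e_apply, e_apply, Ext.mk₀_comp_mk₀_assoc, p_comm, ← Ext.mk₀_comp_mk₀_assoc,
      Ext.comp_assoc_of_third_deg_zero]
  have map_right (a : A) (x : TauGroup F A (ModuleCat.of A A)) :
      e (Φ ((Ext.mk₀ (dualMap F A (rmul A a))).comp x (zero_add 1))) =
        (e (Φ x)).comp (Ext.mk₀ (lmul Aᵐᵒᵖ (op a))) (add_zero 1) := by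
    simp only [Φ_precomp, e_apply, Ext.comp_assoc_of_third_deg_zero, Ext.mk₀_comp_mk₀, q_comm]
  exact ⟨{ Φ.trans e with map_left := map_left, map_right := map_right }⟩

end ExtDuality

section PreprojectiveAlgebra

variable {F : Type u} [Field F] {A : Type u} [Ring A] [Algebra F A]

/-- The element `x` of `τ^{-r} A`, as a homogeneous element of the preprojective algebra. -/
def homog (r : ℕ) : T F A r →+ PreprojAlg F A :=
  (DirectSum.of (Piece F A) r).comp elemMap.toAddMonoidHom

theorem inDeg_eq_homog (r : ℕ) (f : Piece F A r) : inDeg F A r f = homog r (f (1 : A)) :=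
  congrArg (DirectSum.of (Piece F A) r) (elemMap.apply_symm_apply f).symm

theorem homog_injective (r : ℕ) : Function.Injective (homog (F := F) (A := A) r) :=
  (DirectSum.of_injective r).comp elemMap.injective

theorem addHom_ext_homog {X : Type*} [AddCommGroup X] {γ γ' : PreprojAlg F A →+ X}
    (h : ∀ r x, γ (homog r x) = γ' (homog r x)) : γ = γ' :=
  DirectSum.addHom_ext fun r f => by
    change γ (inDeg F A r f) = γ' (inDeg F A r f)
    rw [inDeg_eq_homog, h]

theorem homog_mul_homog_mem_range (s r : ℕ) (y : T F A s) (x : T F A r) :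
    homog s y * homog r x ∈ (homog (F := F) (A := A) (s + r)).range :=
  ⟨_, ((of_mul_of' F A (elemMap y) (elemMap x)).trans (inDeg_eq_homog (s + r) _)).symm⟩

theorem homog_mul_homog_zero (s : ℕ) (y : T F A s) (a : A) :
    homog s y * homog 0 (show T F A 0 from a) = homog s (a • y) := by
  refine (of_mul_of' F A (elemMap y) (elemMap (show T F A 0 from a))).trans
    (congrArg (DirectSum.of (Piece F A) s) ?_)
  change rmul A a ≫ elemMap y ≫ 𝟙 _ = _
  rw [Category.comp_id]
  exact (elemMap_smul a y).symm

variable (F A) in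
/-- The degree zero part of the preprojective algebra. It is `A` with the opposite multiplication,
as `End A` consists of the right multiplications. -/
def scalarHom : Aᵐᵒᵖ →+* PreprojAlg F A where
  toFun a := homog 0 (show T F A 0 from a.unop)
  map_one' := congrArg (DirectSum.of (Piece F A) 0)
    (elemMap.apply_symm_apply (𝟙 (ModuleCat.of A A)))
  map_mul' a b := (homog_mul_homog_zero 0 (show T F A 0 from a.unop) b.unop).symm
  map_zero' := map_zero (homog 0)
  map_add' a b := map_add (homog 0) (show T F A 0 from a.unop) (show T F A 0 from b.unop)

theorem homog_mul_scalarHom (s : ℕ) (y : T F A s) (a : A) :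
    homog s y * scalarHom F A (op a) = homog s (a • y) :=
  homog_mul_homog_zero s y a

theorem scalarHom_mul_homog (r : ℕ) (a : A) (x : T F A r) :
    scalarHom F A (op a) * homog r x = homog r (rightAct F A r a x) := by
  refine (of_mul_of' F A (elemMap (show T F A 0 from a)) (elemMap x)).trans
    (DirectSum.of_eq_of_gradedMonoid_eq (mk_eq_mk F A (zero_add r) _ _ ?_))
  change _ = elemMap ((tauPow F A r).map (rmul A a) x)
  rw [← elemMap_comp x, Category.assoc, Category.assoc, eqToHom_trans]
  exact congrArg (elemMap x ≫ ·) (Category.comp_id _)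

theorem algebraMap_eq_scalarHom (c : F) :
    algebraMap F (PreprojAlg F A) c = scalarHom F A (op (algebraMap F A c)) := by
  rw [DirectSum.algebraMap_apply]
  exact congrArg (DirectSum.of (Piece F A) 0)
    (ModuleCat.hom_ext (LinearMap.ext fun a : A => Algebra.commutes c a))

/-- The element `x ⊗ y` of `τ^{-(r+1)} A = τ⁻A ⊗ τ^{-r} A`. -/
def tens {r : ℕ} (y : T F A r) (x : T F A 1) : T F A (r + 1) :=
  (tauMinus F A).map (elemMap y) x

theorem smul_tens {r : ℕ} (a : A) (y : T F A r) (x : T F A 1) :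
    a • tens y x = tens y (a • x) :=
  (map_smul ((tauMinus F A).map (elemMap y)).hom a x).symm

theorem homog_mul_homog_one (s : ℕ) (y : T F A s) (x : T F A 1) :
    homog s y * homog 1 x = homog (s + 1) (tens y x) := by
  refine (of_mul_of' F A (elemMap y) (elemMap x)).trans
    (congrArg (DirectSum.of (Piece F A) (s + 1)) ?_)
  refine (congrArg (elemMap x ≫ ·) (Category.comp_id ((tauMinus F A).map (elemMap y)))).trans ?_
  exact elemMap_comp (M := (tauMinus F A).obj (ModuleCat.of A A)) x
    ((tauMinus F A).map (elemMap y))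

end PreprojectiveAlgebra

section UniversalProperty

variable {F : Type u} [Field F] {A : Type u} [Ring A] [Algebra F A] [FiniteDimensional F A]

instance T_finite (r : ℕ) : Module.Finite A (T F A r) := by
  induction r with
  | zero => exact inferInstanceAs (Module.Finite A A)
  | succ r ih => exact finite_tauMinus (T F A r)

variable (hτ : RightExactOnFinite (tauMinus F A))
include hτ

theorem addHom_ext_tens {r : ℕ} {X : Type*} [AddCommGroup X] {γ γ' : T F A (r + 1) →+ X}
    (h : ∀ (y : T F A r) (x : T F A 1), γ (tens y x) = γ' (tens y x)) : γ = γ' :=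
  have := IsNoetherianRing.of_finite F A
  hτ.addHom_ext (M := T F A r) h

theorem exists_lift_tens {r : ℕ} {X : Type*} [AddCommGroup X] (β : T F A 1 →+ T F A r →+ X)
    (hβ : ∀ (x : T F A 1) (a : A) (y : T F A r), β (rightAct F A 1 a x) y = β x (a • y)) :
    ∃ γ : T F A (r + 1) →+ X, ∀ (y : T F A r) (x : T F A 1), γ (tens y x) = β x y :=
  have := IsNoetherianRing.of_finite F A
  hτ.exists_lift (M := T F A r) β hβ

/-- The preprojective algebra is generated in degrees `0` and `1`. -/
theorem homog_mem (H : ℕ → AddSubgroup (PreprojAlg F A))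
    (h₀ : ∀ a : Aᵐᵒᵖ, scalarHom F A a ∈ H 0)
    (h₁ : ∀ r, ∀ z ∈ H r, ∀ x : T F A 1, z * homog 1 x ∈ H (r + 1)) (r : ℕ) (x : T F A r) :
    homog r x ∈ H r := by
  induction r with
  | zero => exact h₀ (op x)
  | succ r ih =>
    have mk_comp_homog :
        (QuotientAddGroup.mk' (H (r + 1))).comp (homog (r + 1)) = 0 :=
      addHom_ext_tens hτ fun y x => by
        change QuotientAddGroup.mk' _ (homog (r + 1) (tens y x)) = 0
        rw [← homog_mul_homog_one]
        exact (QuotientAddGroup.eq_zero_iff _).2 (h₁ r _ (ih y) x)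
    exact (QuotientAddGroup.eq_zero_iff _).1 (DFunLike.congr_fun mk_comp_homog x)

theorem addSubgroup_eq_top (H : AddSubgroup (PreprojAlg F A))
    (h₀ : ∀ a : Aᵐᵒᵖ, scalarHom F A a ∈ H)
    (h₁ : ∀ z ∈ H, ∀ x : T F A 1, z * homog 1 x ∈ H) : H = ⊤ := by
  rw [← QuotientAddGroup.ker_mk' H, addHom_ext_homog (γ := QuotientAddGroup.mk' H) (γ' := 0)
    fun r x => (QuotientAddGroup.eq_zero_iff _).2 (homog_mem hτ (fun _ => H) h₀ (fun _ => h₁) r x)]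
  exact AddMonoidHom.ker_zero

theorem ringHom_ext {S : Type*} [Ring S] {ψ ψ' : PreprojAlg F A →+* S}
    (h₀ : ψ.comp (scalarHom F A) = ψ'.comp (scalarHom F A))
    (h₁ : ∀ x : T F A 1, ψ (homog 1 x) = ψ' (homog 1 x)) : ψ = ψ' := by
  have eqLocus_eq_top : (ψ.toAddMonoidHom).eqLocus ψ'.toAddMonoidHom = ⊤ :=
    addSubgroup_eq_top hτ _ (DFunLike.congr_fun h₀) fun z hz x => by
      change ψ (z * homog 1 x) = ψ' (z * homog 1 x)
      rw [map_mul, map_mul, h₁, show ψ z = ψ' z from hz]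
  exact RingHom.ext fun z => eqLocus_eq_top.ge (AddSubgroup.mem_top z)

section Lift

variable {S : Type*} [Ring S] (α : Aᵐᵒᵖ →+* S) (l : T F A 1 →+ S)
  (hl : ∀ (a : A) x, l (a • x) = l x * α (op a))
  (hr : ∀ (a : A) x, l (rightAct F A 1 a x) = α (op a) * l x)
include hl hr

theorem exists_lift_succ {r : ℕ} (ψ : T F A r →+ S)
    (hψ : ∀ (a : A) y, ψ (a • y) = ψ y * α (op a)) :
    ∃ ψ' : T F A (r + 1) →+ S, (∀ (a : A) z, ψ' (a • z) = ψ' z * α (op a)) ∧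
      ∀ (y : T F A r) (x : T F A 1), ψ' (tens y x) = ψ y * l x := by
  let β : T F A 1 →+ T F A r →+ S := (AddMonoidHom.mul.comp ψ).flip.comp l
  obtain ⟨ψ', hψ'⟩ : ∃ ψ' : T F A (r + 1) →+ S, ∀ (y : T F A r) (x : T F A 1),
      ψ' (tens y x) = ψ y * l x := exists_lift_tens hτ β fun x a y => by
    change ψ y * l (rightAct F A 1 a x) = ψ (a • y) * l x
    rw [hr, hψ, mul_assoc]
  refine ⟨ψ', fun a => DFunLike.congr_fun (f := ψ'.comp (DistribSMul.toAddMonoidHom _ a))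
    (g := (AddMonoidHom.mulRight (α (op a))).comp ψ') (addHom_ext_tens hτ fun y x => ?_), hψ'⟩
  change ψ' (a • tens y x) = ψ' (tens y x) * α (op a)
  rw [smul_tens, hψ', hψ', hl, mul_assoc]

theorem exists_addHom_homog_mul : ∃ ψ : PreprojAlg F A →+ S,
    (∀ a, ψ (scalarHom F A a) = α a) ∧
    (∀ z a, ψ (z * scalarHom F A a) = ψ z * α a) ∧
    ∀ z (x : T F A 1), ψ (z * homog 1 x) = ψ z * l x := by
  let V (r : ℕ) := {ψ : T F A r →+ S // ∀ (a : A) y, ψ (a • y) = ψ y * α (op a)}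
  have step (r : ℕ) (ψ : V r) : ∃ ψ' : V (r + 1), ∀ (y : T F A r) (x : T F A 1),
      ψ'.1 (tens y x) = ψ.1 y * l x :=
    let ⟨ψ', smul, succ⟩ := exists_lift_succ hτ α l hl hr ψ.1 ψ.2
    ⟨⟨ψ', smul⟩, succ⟩
  choose next next_tens using step
  let zero : V 0 := ⟨(α : Aᵐᵒᵖ →+ S).comp (opAddEquiv (α := A) : A →+ Aᵐᵒᵖ),
    fun a (y : A) => α.map_mul (op y) (op a)⟩
  let components (r : ℕ) : V r := Nat.rec zero next r
  let ψ : PreprojAlg F A →+ S := DirectSum.toAddMonoid fun r =>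
    (components r).1.comp elemMap.symm.toAddMonoidHom
  have ψ_homog (r : ℕ) (x : T F A r) : ψ (homog r x) = (components r).1 x :=
    (DirectSum.toAddMonoid_of _ _ _).trans
      (congrArg (components r).1 (elemMap.symm_apply_apply x))
  refine ⟨ψ, fun a => ψ_homog 0 _, fun z a => ?_, fun z x => ?_⟩
  · refine DFunLike.congr_fun (f := ψ.comp (AddMonoidHom.mulRight (scalarHom F A a)))
      (g := (AddMonoidHom.mulRight (α a)).comp ψ) (addHom_ext_homog fun r y => ?_) z
    change ψ (homog r y * scalarHom F A (op a.unop)) = ψ (homog r y) * α (op a.unop)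
    rw [homog_mul_scalarHom, ψ_homog, ψ_homog, (components r).2]
  · refine DFunLike.congr_fun (f := ψ.comp (AddMonoidHom.mulRight (homog 1 x)))
      (g := (AddMonoidHom.mulRight (l x)).comp ψ) (addHom_ext_homog fun r y => ?_) z
    change ψ (homog r y * homog 1 x) = ψ (homog r y) * l x
    rw [homog_mul_homog_one, ψ_homog, ψ_homog]
    exact next_tens r (components r) y x

/-- The preprojective algebra is the opposite of the tensor algebra of the bimodule `τ⁻A`. -/
theorem exists_ringHom : ∃ ψ : PreprojAlg F A →+* S,
    ψ.comp (scalarHom F A) = α ∧ ∀ x : T F A 1, ψ (homog 1 x) = l x := by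
  obtain ⟨ψ, ψ_scalar, ψ_mul_scalar, ψ_mul_one⟩ := exists_addHom_homog_mul hτ α l hl hr
  have ψ_one : ψ 1 = 1 := by rw [← map_one (scalarHom F A), ψ_scalar, map_one]
  let multiplicative : AddSubgroup (PreprojAlg F A) :=
    { carrier := {z | ∀ w, ψ (w * z) = ψ w * ψ z}
      zero_mem' := fun w => by simp only [mul_zero, map_zero]
      add_mem' := fun hz hz' w => by simp only [mul_add, map_add, hz w, hz' w]
      neg_mem' := fun hz w => by simp only [mul_neg, map_neg, hz w] }
  have multiplicative_eq_top : multiplicative = ⊤ := by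
    refine addSubgroup_eq_top hτ _ (fun a w => ?_) fun z hz x w => ?_
    · rw [ψ_mul_scalar, ψ_scalar]
    · rw [← mul_assoc, ψ_mul_one, ψ_mul_one, hz w, mul_assoc]
  have map_mul (w z) : ψ (w * z) = ψ w * ψ z := multiplicative_eq_top.ge (AddSubgroup.mem_top z) w
  refine ⟨{ ψ with map_one' := ψ_one, map_mul' := map_mul }, RingHom.ext ψ_scalar, fun x => ?_⟩
  change ψ (homog 1 x) = l x
  rw [← one_mul (homog 1 x), ψ_mul_one, ψ_one, one_mul]

end Lift

end UniversalProperty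

section AntiHomomorphism

variable {F : Type u} [Field F] {A B : Type u} [Ring A] [Algebra F A] [Ring B] [Algebra F B]

/-- The map `θ : τ^{-r} A → τ^{-r} B` turns the left action of `A` into the right action of `B` and
the right action of `A` into the left action of `B`, along the anti-homomorphism `e` from `A`
to `B`. -/
structure Interchanges (e : A →+* Bᵐᵒᵖ) {r : ℕ} (θ : T F A r → T F B r) : Prop where
  map_smul (a : A) (x : T F A r) : θ (a • x) = rightAct F B r (unop (e a)) (θ x)
  map_rightAct (a : A) (x : T F A r) : θ (rightAct F A r a x) = unop (e a) • θ x

/-- The anti-homomorphism `ψ` of preprojective algebras is graded, given by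
`t r : τ^{-r} A → τ^{-r} B` in degree `r`. -/
def HasComponents (ψ : PreprojAlg F A →+* (PreprojAlg F B)ᵐᵒᵖ) (t : ∀ r, T F A r → T F B r) :
    Prop :=
  ∀ r x, ψ (homog r x) = op (homog r (t r x))

theorem hasComponents_iff_inDeg {ψ : PreprojAlg F A →+* (PreprojAlg F B)ᵐᵒᵖ}
    {t : ∀ r, T F A r → T F B r} : HasComponents ψ t ↔ ∀ (r : ℕ) (f : Piece F A r),
      ψ (inDeg F A r f) = op (inDeg F B r (mulMap F B r (t r (f (1 : A))))) :=
  forall_congr' fun r => elemMap.symm.surjective.forall.trans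
    (forall_congr' fun f => by rw [inDeg_eq_homog]; rfl)

theorem op_homog_injective (r : ℕ) : Function.Injective fun x : T F A r => op (homog r x) :=
  op_injective.comp (homog_injective r)

namespace HasComponents

variable {ψ : PreprojAlg F A →+* (PreprojAlg F B)ᵐᵒᵖ} {t : ∀ r, T F A r → T F B r}
  (hψ : HasComponents ψ t)
include hψ

theorem map_add (r : ℕ) (x y : T F A r) : t r (x + y) = t r x + t r y :=
  op_homog_injective r <| by
    change op (homog r (t r (x + y))) = op (homog r (t r x + t r y))
    rw [← hψ, _root_.map_add, _root_.map_add, _root_.map_add, MulOpposite.op_add, hψ, hψ]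

theorem apply_scalarHom {e : A →+* Bᵐᵒᵖ} (h₀ : ∀ a : A, t 0 a = unop (e a)) (a : A) :
    ψ (scalarHom F A (op a)) = op (scalarHom F B (e a)) :=
  (hψ 0 a).trans (congrArg (fun b => op (homog 0 b)) (h₀ a))

theorem interchanges {e : A →+* Bᵐᵒᵖ} (h₀ : ∀ a : A, t 0 a = unop (e a)) (r : ℕ) :
    Interchanges e (t r) where
  map_smul a x := op_homog_injective r <| by
    change op (homog r (t r (a • x))) = op (homog r (rightAct F B r (unop (e a)) (t r x)))
    rw [← hψ, ← homog_mul_scalarHom, map_mul, hψ.apply_scalarHom h₀, hψ, ← scalarHom_mul_homog,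
      op_mul, op_unop]
  map_rightAct a x := op_homog_injective r <| by
    change op (homog r (t r (rightAct F A r a x))) = op (homog r (unop (e a) • t r x))
    rw [← hψ, ← scalarHom_mul_homog, map_mul, hψ.apply_scalarHom h₀, hψ, ← homog_mul_scalarHom,
      op_mul, op_unop]

variable [FiniteDimensional F A] (hτ : RightExactOnFinite (tauMinus F A))
include hτ

theorem unique {ψ' : PreprojAlg F A →+* (PreprojAlg F B)ᵐᵒᵖ} {t' : ∀ r, T F A r → T F B r}
    (hψ' : HasComponents ψ' t') (h₀ : t 0 = t' 0) (h₁ : t 1 = t' 1) : t = t' := by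
  have ψ_eq : ψ = ψ' := ringHom_ext hτ
    (RingHom.ext fun a => by exact (hψ 0 a.unop).trans (h₀ ▸ (hψ' 0 a.unop).symm))
    fun x => by rw [hψ, hψ', h₁]
  funext r x
  refine op_homog_injective r ?_
  change op (homog r (t r x)) = op (homog r (t' r x))
  rw [← hψ, ← hψ', ψ_eq]

theorem leftInverse {φ : PreprojAlg F B →+* (PreprojAlg F A)ᵐᵒᵖ} {t' : ∀ r, T F B r → T F A r}
    (hφ : HasComponents φ t') (h₀ : Function.LeftInverse (t' 0) (t 0))
    (h₁ : Function.LeftInverse (t' 1) (t 1)) (p : PreprojAlg F A) :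
    unop (φ (unop (ψ p))) = p := by
  have comp_homog (r : ℕ) (x : T F A r) :
      unop (φ (unop (ψ (homog r x)))) = homog r (t' r (t r x)) := by
    rw [hψ, unop_op, hφ, unop_op]
  have op_comp_eq_opOp : (RingHom.op φ).comp ψ = RingEquiv.opOp (PreprojAlg F A) :=
    ringHom_ext hτ
      (RingHom.ext fun a => congrArg (fun z => op (op z))
        ((comp_homog 0 a.unop).trans (congrArg (homog 0) (h₀ _))))
      fun x => congrArg (fun z => op (op z)) ((comp_homog 1 x).trans (congrArg (homog 1) (h₁ x)))
  exact congrArg (fun z => unop (unop z)) (DFunLike.congr_fun op_comp_eq_opOp p)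

theorem leftInverse_components {φ : PreprojAlg F B →+* (PreprojAlg F A)ᵐᵒᵖ}
    {t' : ∀ r, T F B r → T F A r} (hφ : HasComponents φ t')
    (h₀ : Function.LeftInverse (t' 0) (t 0)) (h₁ : Function.LeftInverse (t' 1) (t 1)) (r : ℕ) :
    Function.LeftInverse (t' r) (t r) := fun x => homog_injective r <| by
  rw [← hψ.leftInverse hτ hφ h₀ h₁ (homog r x), hψ, unop_op, hφ, unop_op]

end HasComponents

theorem exists_hasComponents [FiniteDimensional F A] (hτ : RightExactOnFinite (tauMinus F A))
    {e : A →+* Bᵐᵒᵖ} {θ : T F A 1 →+ T F B 1} (hθ : Interchanges e θ) :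
    ∃ ψ t, HasComponents (F := F) (A := A) (B := B) ψ t ∧ (∀ a : A, t 0 a = unop (e a)) ∧
      t 1 = θ := by
  let opHomog (r : ℕ) : T F B r →+ (PreprojAlg F B)ᵐᵒᵖ :=
    (opAddEquiv (α := PreprojAlg F B) : PreprojAlg F B →+ _).comp (homog r)
  obtain ⟨ψ, ψ_scalarHom, ψ_one⟩ := exists_ringHom hτ (RingHom.op ((scalarHom F B).comp e))
    ((opHomog 1).comp θ)
    (fun a x => congrArg op ((congrArg (homog 1) (hθ.map_smul a x)).trans
      (scalarHom_mul_homog 1 (unop (e a)) (θ x)).symm))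
    (fun a x => congrArg op ((congrArg (homog 1) (hθ.map_rightAct a x)).trans
      (homog_mul_scalarHom 1 (θ x) (unop (e a))).symm))
  have ψ_homog_mem (r : ℕ) (x : T F A r) : homog r x ∈ (opHomog r).range.comap (ψ : _ →+ _) := by
    refine homog_mem hτ (fun r => (opHomog r).range.comap (ψ : _ →+ _)) (fun a => ?_)
      (fun r z ⟨y, hy⟩ x => ?_) r x
    · exact ⟨unop (e a.unop), (DFunLike.congr_fun ψ_scalarHom a).symm⟩
    · obtain ⟨w, hw⟩ := homog_mul_homog_mem_range 1 r (θ x) y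
      refine Nat.add_comm 1 r ▸ ⟨w, ?_⟩
      change op (homog (1 + r) w) = ψ (z * homog 1 x)
      rw [hw, op_mul, map_mul, ψ_one]
      exact congrArg (· * _) hy
  choose t ht using ψ_homog_mem
  have hψ : HasComponents ψ t := fun r x => (ht r x).symm
  refine ⟨ψ, t, hψ, fun a => op_homog_injective 0 ?_, funext fun x => op_homog_injective 1 ?_⟩
  · exact (hψ 0 a).symm.trans (DFunLike.congr_fun ψ_scalarHom (op a))
  · exact (hψ 1 x).symm.trans (ψ_one x)

end AntiHomomorphism

section AntiIsomorphism

variable {F : Type u} [Field F] {Λ : Type u} [Ring Λ] [Algebra F Λ]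

namespace BimoduleIso

theorem toAddEquiv_injective {r : ℕ} :
    Function.Injective (BimoduleIso.toAddEquiv : BimoduleIso F Λ r → _) := by
  rintro ⟨θ, _, _⟩ ⟨θ', _, _⟩ rfl
  rfl

theorem interchanges {r : ℕ} (θ : BimoduleIso F Λ r) :
    Interchanges (RingEquiv.opOp Λ : Λ →+* Λᵐᵒᵖᵐᵒᵖ) θ.toAddEquiv :=
  ⟨θ.map_left, θ.map_right⟩

theorem interchanges_symm {r : ℕ} (θ : BimoduleIso F Λ r) :
    Interchanges (RingHom.id Λᵐᵒᵖ) θ.toAddEquiv.symm where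
  map_smul a z := by
    rw [AddEquiv.symm_apply_eq]
    exact (congrArg (a • ·) (θ.toAddEquiv.apply_symm_apply z)).symm.trans
      (θ.map_right (unop a) _).symm
  map_rightAct a z := by
    rw [AddEquiv.symm_apply_eq]
    exact (congrArg (rightAct F Λᵐᵒᵖ r a) (θ.toAddEquiv.apply_symm_apply z)).symm.trans
      (θ.map_left (unop a) _).symm

end BimoduleIso

theorem exists_antiIso [FiniteDimensional F Λ] (hl : RightExactOnFinite (tauMinus F Λ))
    (hr : RightExactOnFinite (tauMinus F Λᵐᵒᵖ)) (θ₁ : BimoduleIso F Λ 1) :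
    ∃ (R : PreprojAlg F Λ ≃ₐ[F] (PreprojAlg F Λᵐᵒᵖ)ᵐᵒᵖ) (θ : ∀ r, BimoduleIso F Λ r),
      (∀ a : Λ, (θ 0).toAddEquiv a = op a) ∧ θ 1 = θ₁ ∧
      HasComponents (R : PreprojAlg F Λ →+* _) fun r => (θ r).toAddEquiv := by
  obtain ⟨ψ, t, hψ, t_zero, t_one⟩ :=
    exists_hasComponents hl (θ := θ₁.toAddEquiv.toAddMonoidHom) θ₁.interchanges
  obtain ⟨φ, t', hφ, t'_zero, t'_one⟩ :=
    exists_hasComponents hr (θ := θ₁.toAddEquiv.symm.toAddMonoidHom) θ₁.interchanges_symm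
  have left_zero : Function.LeftInverse (t' 0) (t 0) := fun a : Λ =>
    (t'_zero (t 0 a)).trans (congrArg unop (t_zero a))
  have right_zero : Function.LeftInverse (t 0) (t' 0) := fun a : Λᵐᵒᵖ =>
    (t_zero (t' 0 a)).trans (congrArg op (t'_zero a))
  have left_one : Function.LeftInverse (t' 1) (t 1) := fun x => by
    rw [t_one, t'_one]; exact θ₁.toAddEquiv.symm_apply_apply x
  have right_one : Function.LeftInverse (t 1) (t' 1) := fun x => by
    rw [t_one, t'_one]; exact θ₁.toAddEquiv.apply_symm_apply x
  let R : PreprojAlg F Λ ≃+* (PreprojAlg F Λᵐᵒᵖ)ᵐᵒᵖ :=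
    { ψ with
      invFun q := unop (φ (unop q))
      left_inv := hψ.leftInverse hl hφ left_zero left_one
      right_inv q := congrArg op (hφ.leftInverse hr hψ right_zero right_one (unop q)) }
  have R_algebraMap (c : F) : R (algebraMap F _ c) = algebraMap F _ c := by
    rw [algebraMap_eq_scalarHom, MulOpposite.algebraMap_apply, algebraMap_eq_scalarHom]
    exact hψ.apply_scalarHom t_zero _
  let θ (r : ℕ) : BimoduleIso F Λ r :=
    { toFun := t r
      invFun := t' r
      left_inv := hψ.leftInverse_components hl hφ left_zero left_one r
      right_inv := hφ.leftInverse_components hr hψ right_zero right_one r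
      map_add' := hψ.map_add r
      map_left := (hψ.interchanges t_zero r).map_smul
      map_right := (hψ.interchanges t_zero r).map_rightAct }
  exact ⟨AlgEquiv.ofRingEquiv R_algebraMap, θ, t_zero,
    BimoduleIso.toAddEquiv_injective (AddEquiv.ext (congrFun t_one)), hψ⟩

end AntiIsomorphism

section Corners

variable {F : Type u} [Field F] {A : Type u} [Ring A] [Algebra F A]

theorem rightAct_smul (r : ℕ) (a b : A) (x : T F A r) :
    rightAct F A r a (b • x) = b • rightAct F A r a x :=
  map_smul ((tauPow F A r).map (rmul A a)).hom b x

theorem elemMap_rightAct_smul (r : ℕ) (a b : A) (x : T F A r) :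
    elemMap (rightAct F A r a (b • x)) =
      rmul A b ≫ elemMap x ≫ (tauPow F A r).map (rmul A a) := by
  rw [← Category.assoc, ← elemMap_smul, elemMap_comp]
  rfl

theorem projIncl_comp_projRetr {e : A} (he : IsIdempotentElem e) :
    projIncl A e ≫ projRetr A e = 𝟙 _ := by
  refine ModuleCat.hom_ext (LinearMap.ext fun x => Subtype.ext ?_)
  obtain ⟨a, ha⟩ := Submodule.mem_span_singleton.1 x.2
  change x.1 * e = x.1
  rw [← ha, smul_eq_mul, mul_assoc, he]

/-- The retraction of `cornerIncl`. -/
def cornerRetr (r : ℕ) (e e' : A) (f : Piece F A r) :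
    proj A e ⟶ (tauPow F A r).obj (proj A e') :=
  projIncl A e ≫ f ≫ (tauPow F A r).map (projRetr A e')

theorem cornerRetr_cornerIncl (r : ℕ) {e e' : A} (he : IsIdempotentElem e)
    (he' : IsIdempotentElem e') :
    Function.LeftInverse (cornerRetr (F := F) r e e') (cornerIncl F A r e e') := fun f => by
  simp only [cornerRetr, cornerIncl, Category.assoc]
  rw [← Functor.map_comp, projIncl_comp_projRetr he', reassoc_of% (projIncl_comp_projRetr he),
    CategoryTheory.Functor.map_id, Category.comp_id]

theorem cornerIncl_cornerRetr (r : ℕ) (e e' : A) (f : Piece F A r) :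
    cornerIncl F A r e e' (cornerRetr r e e' f) =
      rmul A e ≫ f ≫ (tauPow F A r).map (rmul A e') := by
  have projRetr_comp_projIncl (e : A) : projRetr A e ≫ projIncl A e = rmul A e := rfl
  simp only [cornerRetr, cornerIncl, ← projRetr_comp_projIncl, Functor.map_comp, Category.assoc]

variable (F) in
/-- The inclusion of `Hom(A e, τ^{-r}(A e'))` into the preprojective algebra. -/
def cornerLin (r : ℕ) (e e' : A) :
    (proj A e ⟶ (tauPow F A r).obj (proj A e')) →ₗ[F] PreprojAlg F A :=
  DirectSum.lof F ℕ (Piece F A) r ∘ₗ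
    { toFun := cornerIncl F A r e e'
      map_add' f g := by
        simp only [cornerIncl, Preadditive.add_comp, Preadditive.comp_add]
      map_smul' c f := by
        simp only [cornerIncl, Linear.smul_comp, Linear.comp_smul, RingHom.id_apply] }

theorem cornerLin_injective (r : ℕ) {e e' : A} (he : IsIdempotentElem e)
    (he' : IsIdempotentElem e') : Function.Injective (cornerLin F r e e') :=
  (DirectSum.of_injective r).comp (cornerRetr_cornerIncl r he he').injective

theorem mem_range_cornerLin (r : ℕ) {e e' : A} (he : IsIdempotentElem e)
    (he' : IsIdempotentElem e') (z : PreprojAlg F A) :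
    z ∈ LinearMap.range (cornerLin F r e e') ↔
      ∃ x : T F A r, rightAct F A r e' (e • x) = x ∧ homog r x = z := by
  constructor
  · rintro ⟨f, rfl⟩
    obtain ⟨x, hx⟩ := elemMap.surjective (cornerIncl F A r e e' f)
    refine ⟨x, elemMap.injective ?_, congrArg (DirectSum.of (Piece F A) r) hx⟩
    rw [elemMap_rightAct_smul, hx, ← cornerIncl_cornerRetr, cornerRetr_cornerIncl r he he']
  · rintro ⟨x, hx, rfl⟩
    refine ⟨cornerRetr r e e' (elemMap x), congrArg (DirectSum.of (Piece F A) r) ?_⟩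
    exact (cornerIncl_cornerRetr r e e' _).trans
      ((elemMap_rightAct_smul r e' e x).symm.trans (congrArg elemMap hx))

theorem exists_linearEquiv_of_map_range_eq {X Y P Q : Type*} [AddCommGroup X] [AddCommGroup Y]
    [AddCommGroup P] [AddCommGroup Q] [Module F X] [Module F Y] [Module F P] [Module F Q]
    {J : X →ₗ[F] P} {K : Y →ₗ[F] Q} (hJ : Function.Injective J) (hK : Function.Injective K)
    (R : P ≃ₗ[F] Q) (h : (LinearMap.range J).map (R : P →ₗ[F] Q) = LinearMap.range K) :
    ∃ φ : X ≃ₗ[F] Y, ∀ x, K (φ x) = R (J x) :=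
  ⟨(LinearEquiv.ofInjective J hJ).trans ((R.ofSubmodules _ _ h).trans
    (LinearEquiv.ofInjective K hK).symm), fun x => congrArg Subtype.val
      ((LinearEquiv.ofInjective K hK).apply_symm_apply
        (R.ofSubmodules _ _ h (LinearEquiv.ofInjective J hJ x)))⟩

variable {Λ : Type u} [Ring Λ] [Algebra F Λ]

theorem BimoduleIso.map_corner {r : ℕ} (θ : BimoduleIso F Λ r) (e e' : Λ) (x : T F Λ r) :
    θ.toAddEquiv (rightAct F Λ r e' (e • x)) =
      rightAct F Λᵐᵒᵖ r (op e) (op e' • θ.toAddEquiv x) := by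
  exact (θ.map_right e' (e • x)).trans ((congrArg (op e' • ·) (θ.map_left e x)).trans
    (rightAct_smul r (op e) (op e') _).symm)

theorem exists_corner_equiv {R : PreprojAlg F Λ ≃ₐ[F] (PreprojAlg F Λᵐᵒᵖ)ᵐᵒᵖ} {r : ℕ}
    (θ : BimoduleIso F Λ r) (hR : ∀ x, R (homog r x) = op (homog r (θ.toAddEquiv x)))
    {e e' : Λ} (he : IsIdempotentElem e) (he' : IsIdempotentElem e') :
    ∃ φ : (proj Λ e ⟶ (tauPow F Λ r).obj (proj Λ e')) ≃ₗ[F]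
        (proj Λᵐᵒᵖ (op e') ⟶ (tauPow F Λᵐᵒᵖ r).obj (proj Λᵐᵒᵖ (op e))),
      ∀ f, R (inDeg F Λ r (cornerIncl F Λ r e e' f)) =
        op (inDeg F Λᵐᵒᵖ r (cornerIncl F Λᵐᵒᵖ r (op e') (op e) (φ f))) := by
  have op_e : IsIdempotentElem (op e) := congrArg op he
  have op_e' : IsIdempotentElem (op e') := congrArg op he'
  let S : PreprojAlg F Λ ≃ₗ[F] PreprojAlg F Λᵐᵒᵖ :=
    R.toLinearEquiv.trans (opLinearEquiv F).symm
  have S_homog (x : T F Λ r) : S (homog r x) = homog r (θ.toAddEquiv x) := congrArg unop (hR x)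
  have map_range : (LinearMap.range (cornerLin F r e e')).map (S : _ →ₗ[F] _) =
      LinearMap.range (cornerLin F r (op e') (op e)) := by
    ext q
    rw [mem_range_cornerLin r op_e' op_e, θ.toAddEquiv.surjective.exists, Submodule.mem_map]
    constructor
    · rintro ⟨z, hz, rfl⟩
      obtain ⟨x, hx, rfl⟩ := (mem_range_cornerLin r he he' z).1 hz
      exact ⟨x, by rw [← θ.map_corner, hx], (S_homog x).symm⟩
    · rintro ⟨x, hx, rfl⟩
      rw [← θ.map_corner, θ.toAddEquiv.injective.eq_iff] at hx
      exact ⟨homog r x, (mem_range_cornerLin r he he' _).2 ⟨x, hx, rfl⟩, S_homog x⟩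
  obtain ⟨φ, hφ⟩ := exists_linearEquiv_of_map_range_eq (cornerLin_injective r he he')
    (cornerLin_injective r op_e' op_e) S map_range
  exact ⟨φ, fun f => congrArg op (hφ f).symm⟩

end Corners

end

end Preproj

theorem corollary3p4 (F : Type u) [Field F] (Λ : Type u) [Ring Λ] [Algebra F Λ]
    [FiniteDimensional F Λ] (hΛ : IsHereditary Λ) :
    Nonempty (Preproj.BimoduleIso F Λ 1) ∧
    ∀ θ₁ : Preproj.BimoduleIso F Λ 1,
      ∃! θ : ∀ r : ℕ, Preproj.BimoduleIso F Λ r,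
        (∀ a : Λ, (θ 0).toAddEquiv a = op a) ∧ θ 1 = θ₁ ∧
        ∃ R : Preproj.PreprojAlg F Λ ≃ₐ[F] (Preproj.PreprojAlg F Λᵐᵒᵖ)ᵐᵒᵖ,
          (∀ (r : ℕ) (f : Preproj.Piece F Λ r),
            R (Preproj.inDeg F Λ r f) =
              op (Preproj.inDeg F Λᵐᵒᵖ r
                (Preproj.mulMap F Λᵐᵒᵖ r ((θ r).toAddEquiv (f (1 : Λ)))))) ∧
          ∀ (r : ℕ) (e e' : Λ), IsIdempotentElem e → IsIdempotentElem e' →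
            ∃ φ : (Preproj.proj Λ e ⟶ (Preproj.tauPow F Λ r).obj (Preproj.proj Λ e')) ≃ₗ[F]
                (Preproj.proj Λᵐᵒᵖ (op e') ⟶
                  (Preproj.tauPow F Λᵐᵒᵖ r).obj (Preproj.proj Λᵐᵒᵖ (op e))),
              ∀ f, R (Preproj.inDeg F Λ r (Preproj.cornerIncl F Λ r e e' f)) =
                op (Preproj.inDeg F Λᵐᵒᵖ r
                  (Preproj.cornerIncl F Λᵐᵒᵖ r (op e') (op e) (φ f))) := by
  refine ⟨Preproj.nonempty_bimoduleIso_one, fun θ₁ => ?_⟩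
  have hl := Preproj.rightExactOnFinite_tauMinus (F := F) hΛ
  have hr := Preproj.rightExactOnFinite_tauMinus_op (F := F) hΛ
  obtain ⟨R, θ, θ_zero, θ_one, hR⟩ := Preproj.exists_antiIso hl hr θ₁
  refine ⟨θ, ⟨θ_zero, θ_one, R, Preproj.hasComponents_iff_inDeg.1 hR, fun r e e' he he' =>
    Preproj.exists_corner_equiv (θ r) (hR r) he he'⟩, ?_⟩
  rintro θ' ⟨θ'_zero, θ'_one, R', hR', -⟩
  have components_eq := (Preproj.hasComponents_iff_inDeg (ψ := (R' : _ →+* _))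
    (t := fun r => (θ' r).toAddEquiv).2 hR').unique hl hR
    (funext fun a => (θ'_zero a).trans (θ_zero a).symm) (by simp only [θ_one, θ'_one])
  exact funext fun r => Preproj.BimoduleIso.toAddEquiv_injective
    (DFunLike.coe_injective (congrFun components_eq r))
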